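/- Conventions. Fix a non-principal ultrafilter $\mathfrak u$ on $\mathbb N$. Let $G$ be a compactly generated, unimodular, locally compact second countable (Hausdorff) group with Haar measure $\lambda$. For a probability measure preserving Borel action of $G$ on a standard probability space $(X,\mu)$ and an open relatively compact neighborhood $U'$ of the identity, a $U'$-cross section is a Borel set $Y\subset X$ such that $(g,y)\mapsto gy$ is injective on $U'\times Y$ and $\mu(X\setminus GY)=0$. Its covolume is $\operatorname{covol}(Y)=\lambda(U')/\mu(U'Y)$ and it carries the probability measure $\nu(B)=\mu(U'B)/\mu(U'Y)$; these are characterized by $\Phi_*(\lambda|_{U'}\times\nu)=\operatorname{covol}(Y)\,\mu|_{U'Y}$, where $\Phi(g,y)=gy$. For a sequence of such actions on $(X_n,\mu_n)$ with cross sections $Y_n$, let $Y_{\mathfrak u}=[Y_n]_{\mathfrak u}$ be the set-theoretic ultraproduct with the Loeb measure $\nu_{\mathfrak u}$ of $(\nu_n)_n$; let $X^R_{\mathfrak u}=\prod_n X_n/\sim$, where $(x_n)\sim(x_n')$ if there are $g_n\in G$ with $\lim_{\mathfrak u}g_n=1$ and $g_nx_n=x_n'$ for $\mathfrak u$-almost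 every $n$, with the action $g[x_n]=[gx_n]$; and let $\Psi:G\times Y_{\mathfrak u}\to X_{\mathfrak u}^R$, $\Psi(g,[y_n]_{\mathfrak u})=[gy_n]$. Put $$\mathcal R_n=\{(y,y')\in Y_n^2:\ y'\in Gy\},\qquad \mathcal R_{\mathfrak u}=\{(y,y')\in Y_{\mathfrak u}^2:\ \Psi(1,y')\in G\,\Psi(1,y)\}$$ (the cross equivalence relations). For a symmetric set $K\subset G$ let $\Theta_n^K=\{(y,y')\in\mathcal R_n: y'\in Ky\}$, let $\Theta_{\mathfrak u}^K=\{(y,y')\in\mathcal R_{\mathfrak u}:\Psi(1,y')\in K\Psi(1,y)\}$, and let $\mathcal R_n^K,\mathcal R_{\mathfrak u}^K$ be the equivalence relations they generate. $\mathcal R_{\mathfrak u}$ is called $K$-generated if $\mathcal R_{\mathfrak u}^K$ and $\mathcal R_{\mathfrak u}$ agree outside a $\nu_{\mathfrak u}$-null set. Theorem. Let $U'\subset G$ be an open relatively compact neighborhood of the identity. Let $G$ act in a Borel and measure preserving way on the standard probability spaces $(X_n,\mu_n)$, $n\in\mathbb N$, let $Y_n\subset X_n$ be $U'$-cross sections and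 assume that $\{\operatorname{covol}(Y_n)^{-1}\}_n$ is bounded. Let $U\subset U'$ and $K'\supset U$ be compact neighborhoods of the identity and assume that $\lim_{\mathfrak u}\mu_n(K'Y_n)=1$. Then there is a compact symmetric set $K\supset K'$ such that 1. the cross equivalence relation $\mathcal R_{\mathfrak u}$ on $Y_{\mathfrak u}$ is $K$-generated; 2. the ultraproduct of the graphed equivalence relations $(\mathcal R_n^K,\Theta_n^K)$ is $(\mathcal R_{\mathfrak u},\Theta^K_{\mathfrak u})$. That is, there are finitely many $g_j\in G$ and Borel neighborhoods of the identity $V_j\subset U$ with $g_jV_jg_j^{-1}V_j\cup g_j^{-1}V_j^{-1}g_j\subset U$ and $\bigcup_jV_j^{-1}g_j=K$ such that: for every $n$ the sets $\{(y,y')\in Y_n^2:\ g_jy\in V_jy'\}$ are the graphs of measurable, $\nu_n$-preserving, partially defined bijections $\varphi_n^j$ of $Y_n$ (whose graphs have union $\Theta_n^K$); the sets $\{(y,y')\in Y_{\mathfrak u}^2:\ \Psi(g_j,y)\in V_j\Psi(1,y')\}$ are the graphs of measurable, $\nu_{\mathfrak u}$-preserving, partially defined bijections $\psi^j$ of $Y_{\mathfrak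 u}$ (whose graphs have union $\Theta^K_{\mathfrak u}$); for every $j$ the ultraproduct $[\varphi^j_n]_{\mathfrak u}:[y_n]_{\mathfrak u}\mapsto[\varphi_n^j(y_n)]_{\mathfrak u}$, with domain $[\operatorname{dom}\varphi_n^j]_{\mathfrak u}$, coincides with $\psi^j$ up to a $\nu_{\mathfrak u}$-null set; and the equivalence relation generated by the $[\varphi_n^j]_{\mathfrak u}$ agrees with $\mathcal R_{\mathfrak u}$ outside a $\nu_{\mathfrak u}$-null set. -/

import Mathlib

open MeasureTheory Filter Topology Set
open scoped Pointwise ENNReal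

namespace CrossUltra

/-! ### Ultraproducts of sets and the Loeb measure -/

section Loeb

variable {Y : ℕ → Type*} [∀ n, MeasurableSpace (Y n)]

/-- The ultraproduct `[Y_n]_𝔲` of the probability spaces `(Y_n, ν_n)`; the measures are recorded in
the type since its σ-algebra depends on them. -/
def LoebSpace (𝔲 : Ultrafilter ℕ) (_ν : ∀ n, Measure (Y n)) : Type _ :=
  (𝔲 : Filter ℕ).Product Y

variable (𝔲 : Ultrafilter ℕ) (ν : ∀ n, Measure (Y n))

/-- The class `[y_n]_𝔲` of a sequence. -/
def LoebSpace.mk (y : ∀ n, Y n) : LoebSpace 𝔲 ν :=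
  Quotient.mk ((𝔲 : Filter ℕ).productSetoid Y) y

/-- The class `[A_n]_𝔲` of a sequence of subsets. -/
def internalSet (A : ∀ n, Set (Y n)) : Set (LoebSpace 𝔲 ν) :=
  {x | ∃ a : ∀ n, Y n, x = LoebSpace.mk 𝔲 ν a ∧ ∀ᶠ n in (𝔲 : Filter ℕ), a n ∈ A n}

/-- The ultraproduct `[r_n]_𝔲` of a sequence of binary relations. -/
def ultraRel (r : ∀ n, Y n → Y n → Prop) (x y : LoebSpace 𝔲 ν) : Prop :=
  ∃ a b : ∀ n, Y n, x = LoebSpace.mk 𝔲 ν a ∧ y = LoebSpace.mk 𝔲 ν b ∧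
    ∀ᶠ n in (𝔲 : Filter ℕ), r n (a n) (b n)

/-- The infimum of `lim_𝔲 ν_n(A_n)` over the sequences of measurable sets with `S ⊆ [A_n]_𝔲`.
The limits exist because `[0, ∞]` is compact. -/
noncomputable def loebContent (S : Set (LoebSpace 𝔲 ν)) : ℝ≥0∞ :=
  ⨅ (A : ∀ n, Set (Y n)) (_ : ∀ n, MeasurableSet (A n)) (_ : S ⊆ internalSet 𝔲 ν A),
    limUnder (𝔲 : Filter ℕ) (fun n => ν n (A n))

theorem loebContent_empty : loebContent 𝔲 ν ∅ = 0 := by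
  refine le_antisymm ?_ bot_le
  refine (iInf_le_of_le (fun _ => ∅) (iInf_le_of_le (fun _ => MeasurableSet.empty)
    (iInf_le_of_le (empty_subset _) ?_)))
  simp only [measure_empty]
  exact (tendsto_const_nhds.limUnder_eq).le

/-- The Loeb outer measure. -/
noncomputable def loebOuter : OuterMeasure (LoebSpace 𝔲 ν) :=
  OuterMeasure.ofFunction (loebContent 𝔲 ν) (loebContent_empty 𝔲 ν)

/-- The (complete) Loeb σ-algebra. -/
noncomputable instance instMeasurableSpaceLoeb : MeasurableSpace (LoebSpace 𝔲 ν) := (loebOuter 𝔲 ν).caratheodory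

/-- The Loeb measure `ν_𝔲`, with `ν_𝔲([A_n]_𝔲) = lim_𝔲 ν_n(A_n)`. -/
noncomputable def loebMeasure : Measure (LoebSpace 𝔲 ν) :=
  (loebOuter 𝔲 ν).toMeasure le_rfl

end Loeb

/-! ### The regular ultraproduct -/

section Regular

variable (G : Type*) [Group G] [TopologicalSpace G] [IsTopologicalGroup G]
  (𝔲 : Ultrafilter ℕ) (X : ℕ → Type*) [∀ n, MulAction G (X n)]

/-- `(x_n) ∼ (y_n)` if there is a sequence `g_n` in `G` with `lim_𝔲 g_n = 1` and `g_n x_n = y_n` for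
`𝔲`-almost every `n`. -/
def regularSetoid : Setoid (∀ n, X n) where
  r x y := ∃ g : ℕ → G, Tendsto g 𝔲 (𝓝 1) ∧ ∀ᶠ n in (𝔲 : Filter ℕ), g n • x n = y n
  iseqv :=
    { refl := fun x => ⟨fun _ => 1, tendsto_const_nhds, by simp⟩
      symm := by
        rintro x y ⟨g, hg, h⟩
        refine ⟨fun n => (g n)⁻¹, by simpa using hg.inv, h.mono fun n hn => ?_⟩
        rw [← hn, inv_smul_smul]
      trans := by
        rintro x y z ⟨g, hg, h⟩ ⟨g', hg', h'⟩
        refine ⟨fun n => g' n * g n, by simpa using hg'.mul hg, (h.and h').mono fun n hn => ?_⟩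
        rw [mul_smul, hn.1, hn.2] }

/-- The underlying set `[X_n]_𝔲^R` of the regular ultraproduct. -/
def RegularUltraproduct : Type _ := Quotient (regularSetoid G 𝔲 X)

/-- The class `[x_n]_𝔲^R`. -/
def RegularUltraproduct.mk (x : ∀ n, X n) : RegularUltraproduct G 𝔲 X :=
  Quotient.mk (regularSetoid G 𝔲 X) x

/-- The action `g [x_n]_𝔲^R = [g x_n]_𝔲^R`. -/
instance instMulActionRegular : MulAction G (RegularUltraproduct G 𝔲 X) where
  smul g := Quotient.map (sa := regularSetoid G 𝔲 X) (sb := regularSetoid G 𝔲 X)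
    (fun x n => g • x n) (by
      rintro x y ⟨h, hh, hxy⟩
      refine ⟨fun n => g * h n * g⁻¹, ?_, hxy.mono fun n hn => ?_⟩
      · simpa using (hh.const_mul g).mul_const g⁻¹
      · change (g * h n * g⁻¹) • g • x n = g • y n
        rw [← hn, mul_smul, inv_smul_smul, mul_smul])
  one_smul x := by
    induction x using Quotient.inductionOn with
    | h x => exact congrArg (Quotient.mk (regularSetoid G 𝔲 X)) (funext fun n => one_smul G (x n))
  mul_smul g h x := by
    induction x using Quotient.inductionOn with
    | h x => exact congrArg (Quotient.mk (regularSetoid G 𝔲 X)) (funext fun n => mul_smul g h (x n))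

variable {X}

/-- The map `Ψ : G × Y_𝔲 → X_𝔲^R`, `Ψ(g, [y_n]_𝔲) = [g y_n]_𝔲^R`. -/
def ultraPsi [∀ n, MeasurableSpace (X n)] {Y : ∀ n, Set (X n)} (ν : ∀ n, Measure (Y n)) (g : G) :
    LoebSpace 𝔲 ν → RegularUltraproduct G 𝔲 X :=
  Quotient.lift (s := (𝔲 : Filter ℕ).productSetoid fun n => Y n)
    (fun y => RegularUltraproduct.mk G 𝔲 X fun n => g • (y n : X n)) (by
      intro y y' h
      refine Quotient.sound (s := regularSetoid G 𝔲 X) ⟨fun _ => 1, tendsto_const_nhds, ?_⟩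
      have h' : ∀ᶠ n in (𝔲 : Filter ℕ), y n = y' n := h
      exact h'.mono fun n hn => by simp [hn])

end Regular

/-! ### Cross sections -/

section Cross

variable {G : Type*} [Group G]

/-- `Y` is a `U`-cross section of the action of `G` on `(X, μ)`. -/
structure IsCrossSection {X : Type*} [MeasurableSpace X] [MulAction G X] (μ : Measure X)
    (U : Set G) (Y : Set X) : Prop where
  measurableSet : MeasurableSet Y
  injOn : InjOn (fun p : G × X => p.1 • p.2) (U ×ˢ Y)
  conull : μ ((univ : Set G) • Y)ᶜ = 0

/-- The covolume `covol(Y) = λ(U) / μ(U Y)` of a `U`-cross section `Y`. -/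
noncomputable def covolume {X : Type*} [MeasurableSpace X] [MulAction G X] [MeasurableSpace G]
    (haar : Measure G) (μ : Measure X) (U : Set G) (Y : Set X) : ℝ≥0∞ :=
  haar U / μ (U • Y)

/-- The probability measure `ν(B) = μ(U B) / μ(U Y)` on a `U`-cross section `Y`. It and the covolume
are characterized by `Φ_*(λ|_U × ν) = covol(Y) μ|_{UY}`, where `Φ(g, y) = g y`. -/
noncomputable def crossMeasure {X : Type*} [MeasurableSpace X] [MulAction G X] [MeasurableSpace G]
    (μ : Measure X) (U : Set G) (Y : Set X) : Measure Y :=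
  (μ (U • Y))⁻¹ • (μ.comap (fun p : U × Y => (p.1 : G) • (p.2 : X))).map Prod.snd

/-- For a Borel cross section `Y ⊆ X`, the map `Ψ` is the restriction of the action map. -/
def actPsi {X : Type*} [MulAction G X] (Y : Set X) (g : G) (y : Y) : X := g • (y : X)

variable {X Y : Type*} [MulAction G X] (Ψ : G → Y → X)

/-- The cross equivalence relation of `Ψ : G × Y → X`: the points `Ψ(1, y)` and `Ψ(1, y')` are in
the same `G`-orbit. -/
def crossRel : Setoid Y where
  r y y' := ∃ g : G, g • Ψ 1 y = Ψ 1 y'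
  iseqv :=
    { refl := fun y => ⟨1, one_smul _ _⟩
      symm := by
        rintro y y' ⟨g, h⟩
        exact ⟨g⁻¹, by rw [← h, inv_smul_smul]⟩
      trans := by
        rintro x y z ⟨g, h⟩ ⟨g', h'⟩
        exact ⟨g' * g, by rw [mul_smul, h, h']⟩ }

/-- The set `Θ^K` of the couples `(y, y')` with `y' ∈ K y`. -/
def crossEdge (K : Set G) (y y' : Y) : Prop := ∃ k ∈ K, k • Ψ 1 y = Ψ 1 y'

/-- The equivalence relation `R^K` generated by `Θ^K`. -/
def crossRelGen (K : Set G) : Setoid Y := Relation.EqvGen.setoid (crossEdge Ψ K)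

/-- Two equivalence relations agree outside a null set. -/
def AEEqSetoid [MeasurableSpace Y] (ν : Measure Y) (R S : Setoid Y) : Prop :=
  ∃ N : Set Y, ν N = 0 ∧ ∀ y ∉ N, ∀ y' ∉ N, R y y' ↔ S y y'

/-- The cross section `(Y, Ψ)` is `K`-generated. -/
def IsKGenerated [MeasurableSpace Y] (ν : Measure Y) (K : Set G) : Prop :=
  AEEqSetoid ν (crossRelGen Ψ K) (crossRel Ψ)

end Cross

/-! ### Graphings and their ultraproducts -/

section Graphing

/-- A measurable and measure preserving partially defined bijection of `(Y, ν)`. -/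
structure PartialAut {Y : Type*} [MeasurableSpace Y] (ν : Measure Y) extends PartialEquiv Y Y where
  measurableSet_source : MeasurableSet source
  measurableSet_target : MeasurableSet target
  measurable_toFun : ∀ B, MeasurableSet B → MeasurableSet (source ∩ toFun ⁻¹' B)
  measurable_invFun : ∀ B, MeasurableSet B → MeasurableSet (target ∩ invFun ⁻¹' B)
  measure_preserving : ∀ B ⊆ target, MeasurableSet B → ν (source ∩ toFun ⁻¹' B) = ν B

/-- The graph of a partial automorphism. -/
def PartialAut.graph {Y : Type*} [MeasurableSpace Y] {ν : Measure Y} (φ : PartialAut ν)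
    (y y' : Y) : Prop :=
  y ∈ φ.source ∧ φ.toFun y = y'

/-- An equivalence relation together with a graphing, indexed by `ι`, that generates it up to a null
set. -/
structure GraphedRel {Y : Type*} [MeasurableSpace Y] (ν : Measure Y) (ι : Type) where
  rel : Setoid Y
  graphing : ι → PartialAut ν
  graph_le : ∀ i y y', (graphing i).graph y y' → rel y y'
  generates :
    AEEqSetoid ν (Relation.EqvGen.setoid fun y y' => ∃ i, (graphing i).graph y y') rel

/-- `𝒮` is (up to null sets) the ultraproduct of the graphed equivalence relations `𝓡 n`: for each
index `i` the `i`-th element of its graphing is almost everywhere the partial automorphism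
`[φ_n^i]_𝔲 : [y_n]_𝔲 ↦ [φ_n^i(y_n)]_𝔲` with domain `[dom φ_n^i]_𝔲`, and its equivalence relation
agrees with the one generated by the `[φ_n^i]_𝔲`. -/
def IsUltraproductOfGraphed {Y : ℕ → Type*} [∀ n, MeasurableSpace (Y n)] (𝔲 : Ultrafilter ℕ)
    (ν : ∀ n, Measure (Y n)) {ι : Type} (𝓡 : ∀ n, GraphedRel (ν n) ι)
    (𝒮 : GraphedRel (loebMeasure 𝔲 ν) ι) : Prop :=
  (∀ i, ∀ᵐ y ∂(loebMeasure 𝔲 ν), ∀ y',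
    ultraRel 𝔲 ν (fun n => ((𝓡 n).graphing i).graph) y y' ↔ (𝒮.graphing i).graph y y') ∧
  AEEqSetoid (loebMeasure 𝔲 ν)
    (Relation.EqvGen.setoid fun y y' =>
      ∃ i, ultraRel 𝔲 ν (fun n => ((𝓡 n).graphing i).graph) y y') 𝒮.rel

variable {G : Type*} [Group G] [TopologicalSpace G] [MeasurableSpace G]

/-- Finitely many elements `g_j` of `G` and neighborhoods of the identity `V_j ⊆ U` such that the
partial automorphisms `φ_j` with `φ_j(y) = y'` iff `g_j y ∈ V_j y'` are well defined on every
`U`-cross section, and such that `⋃_j V_j⁻¹ g_j = K`. -/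
structure KGraphingCode (U K : Set G) (m : ℕ) where
  g : Fin m → G
  V : Fin m → Set G
  measurableSet : ∀ j, MeasurableSet (V j)
  mem_nhds : ∀ j, V j ∈ 𝓝 (1 : G)
  subset : ∀ j, V j ⊆ U
  conj_mul_subset : ∀ j, ({g j} * V j * {(g j)⁻¹}) * V j ⊆ U
  conj_inv_subset : ∀ j, {(g j)⁻¹} * (V j)⁻¹ * {g j} ⊆ U
  iUnion_eq : ⋃ j, (V j)⁻¹ * {g j} = K

/-- The graphing of the graphed relation `𝓡` is the `K`-graphing `Θ^K` of `(Y, Ψ)`, presented by the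
partial automorphisms attached to the code `c`; in particular the union of their graphs is `Θ^K`. -/
def IsKGraphing {X Y : Type*} [MulAction G X] [MeasurableSpace Y] {ν : Measure Y} (Ψ : G → Y → X)
    {U K : Set G} {m : ℕ} (c : KGraphingCode U K m) (𝓡 : GraphedRel ν (Fin m)) : Prop :=
  (∀ j y y', (𝓡.graphing j).graph y y' ↔ ∃ v ∈ c.V j, c.g j • Ψ 1 y = v • Ψ 1 y') ∧
  ∀ y y', (∃ j, (𝓡.graphing j).graph y y') ↔ crossEdge Ψ K y y'

end Graphing

end CrossUltra

/-!
The cross equivalence relation of an ultraproduct of cross sections is the ultraproduct of the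
cross equivalence relations, restricted to a suitable compact set `K` of group elements.

*The finite stages.* The action map `Φ : G × Y → X` is injective on `g U' × Y` for every `g`, so
images of Borel sets under it are Borel (Lusin-Souslin), and there is a measure on `G × Y` that `Φ`
maps locally isomorphically to `μ` (`IsCrossSection.exists_orbitMeasure`). This measure is left
invariant, hence a multiple of `λ × ν` by uniqueness of the Haar measure
(`IsCrossSection.orbitMeasure_eq_prod`). If `S ⊆ G` is such that `Θ^S` is the graph of a partial
bijection, then right invariance of `λ` shows that this bijection preserves `ν`
(`IsCrossSection.crossMeasure_relPreimage`).

*The Loeb measure.* By countable saturation the Loeb content is countably subadditive, hence equal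
to the Loeb outer measure. A sequence of measure preserving relations therefore gives a relation
that does not increase the outer measure of any set, in either direction, and this is all that is
needed for a partial automorphism of the Carathéodory measure space
(`exists_partialAut_of_outerMeasure`).

*Comparison.* The relation `Ψ(1, y') ∈ S Ψ(1, y)` means that `y'_n = h_n y_n` with `lim_𝔲 h_n ∈ S`,
while the ultraproduct of the `Θ_n^S` requires `h_n ∈ S` for almost every `n`. For compact `S` the
two differ only if `lim_𝔲 h_n` is in `S \ int S`. Almost all level sets of a compactly supported
function on `G` are avoided by the limits `lim_𝔲 h_n` for almost every `y`
(`countable_setOf_level_ne_zero`): a compact set contains a bounded number of `h` with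
`h y_n ∈ Y_n`, so that disjoint level sets share a finite total measure. Consequently `K` and the
pieces `V_j⁻¹ g_j` can be built from super-level sets at generic levels
(`exists_kGraphingCode`).

*Generation.* As `μ_n(K' Y_n) → 1`, almost every `y` has all of its translates `g Ψ(1, y)` in
`K₁ Ψ(1, Y_𝔲)`, where `K₁ = U U⁻¹ K'` (`exists_null_forall_smul_eq_smul`). A word in the generators
of `G` from `Ψ(1, y)` to `Ψ(1, y')` then stays within bounded distance of the cross section, and is
shadowed by a path of `K`-edges as soon as `K` contains `K₁⁻¹ C K₁` for a compact symmetric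
generating set `C` containing the identity (`crossRelGen_of_forall_smul_eq_smul`).
-/

namespace CrossUltra

/-! ### The Loeb outer measure -/

section LoebTheory

variable {Y : ℕ → Type*} [∀ n, MeasurableSpace (Y n)] {𝔲 : Ultrafilter ℕ} {ν : ∀ n, Measure (Y n)}

theorem LoebSpace.mk_surjective : Function.Surjective (LoebSpace.mk 𝔲 ν) :=
  fun x => Quotient.exists_rep (s := (𝔲 : Filter ℕ).productSetoid Y) x

theorem LoebSpace.mk_eq_mk {a b : ∀ n, Y n} :
    LoebSpace.mk 𝔲 ν a = LoebSpace.mk 𝔲 ν b ↔ ∀ᶠ n in (𝔲 : Filter ℕ), a n = b n :=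
  Quotient.eq (r := (𝔲 : Filter ℕ).productSetoid Y)

theorem mk_mem_internalSet {A : ∀ n, Set (Y n)} {a : ∀ n, Y n} :
    LoebSpace.mk 𝔲 ν a ∈ internalSet 𝔲 ν A ↔ ∀ᶠ n in (𝔲 : Filter ℕ), a n ∈ A n := by
  constructor
  · rintro ⟨b, hab, hb⟩
    filter_upwards [LoebSpace.mk_eq_mk.1 hab, hb] with n h1 h2
    rwa [h1]
  · exact fun h => ⟨a, rfl, h⟩

theorem ultraRel_mk_mk {r : ∀ n, Y n → Y n → Prop} {a b : ∀ n, Y n} :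
    ultraRel 𝔲 ν r (LoebSpace.mk 𝔲 ν a) (LoebSpace.mk 𝔲 ν b) ↔
      ∀ᶠ n in (𝔲 : Filter ℕ), r n (a n) (b n) := by
  constructor
  · rintro ⟨a', b', ha, hb, h⟩
    filter_upwards [LoebSpace.mk_eq_mk.1 ha, LoebSpace.mk_eq_mk.1 hb, h] with n h1 h2 h3
    rwa [h1, h2]
  · exact fun h => ⟨a, b, rfl, rfl, h⟩

theorem tendsto_limUnder_ultrafilter (𝔲 : Ultrafilter ℕ) (f : ℕ → ℝ≥0∞) :
    Tendsto f 𝔲 (𝓝 (limUnder (𝔲 : Filter ℕ) f)) :=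
  tendsto_nhds_limUnder ⟨_, (𝔲.map f).le_nhds_lim⟩

/-- Diagonal selection along a non-principal ultrafilter, the source of countable saturation. -/
theorem exists_tendsto_atTop_of_forall_eventually (h𝔲 : (𝔲 : Filter ℕ) ≤ cofinite)
    {p : ℕ → ℕ → Prop} (hp : ∀ k, ∀ᶠ n in (𝔲 : Filter ℕ), p k n) :
    ∃ k : ℕ → ℕ, Tendsto k 𝔲 atTop ∧ ∀ᶠ n in (𝔲 : Filter ℕ), p (k n) n := by
  classical
  refine ⟨fun n => Nat.findGreatest (fun k => p k n) n, tendsto_atTop.2 fun m => ?_, ?_⟩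
  · have h : ∀ᶠ n in (𝔲 : Filter ℕ), m ≤ n :=
      (h𝔲.trans Nat.cofinite_eq_atTop.le) (eventually_ge_atTop m)
    filter_upwards [hp m, h] with n h1 h2
    exact Nat.le_findGreatest h2 h1
  · filter_upwards [hp 0] with n hn
    exact Nat.findGreatest_spec (P := fun k => p k n) (Nat.zero_le n) hn

theorem loebContent_le {S : Set (LoebSpace 𝔲 ν)} {A : ∀ n, Set (Y n)}
    (hA : ∀ n, MeasurableSet (A n)) (hS : S ⊆ internalSet 𝔲 ν A) {c : ℝ≥0∞}
    (hc : ∀ᶠ n in (𝔲 : Filter ℕ), ν n (A n) ≤ c) : loebContent 𝔲 ν S ≤ c :=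
  (iInf_le_of_le A (iInf_le_of_le hA (iInf_le _ hS))).trans
    (le_of_tendsto (tendsto_limUnder_ultrafilter 𝔲 _) hc)

theorem loebContent_mono {S T : Set (LoebSpace 𝔲 ν)} (h : S ⊆ T) :
    loebContent 𝔲 ν S ≤ loebContent 𝔲 ν T :=
  le_iInf fun A => le_iInf fun hA => le_iInf fun hT =>
    iInf_le_of_le A (iInf_le_of_le hA (iInf_le _ (h.trans hT)))

/-- Given covers `[A^i]` of the `S i`, a diagonal sequence `⋃ i < k(n), A^i_n` with `k(n) → ∞` slowly
enough covers all of them at a cost of at most the sum. -/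
theorem loebContent_iUnion_le (h𝔲 : (𝔲 : Filter ℕ) ≤ cofinite) (S : ℕ → Set (LoebSpace 𝔲 ν)) :
    loebContent 𝔲 ν (⋃ i, S i) ≤ ∑' i, loebContent 𝔲 ν (S i) := by
  refine ENNReal.le_of_forall_pos_le_add fun ε hε hfin => ?_
  obtain ⟨δ, hδ, hδε⟩ := ENNReal.exists_pos_sum_of_countable (ENNReal.coe_pos.2 hε).ne' ℕ
  have hA : ∀ i, ∃ A : ∀ n, Set (Y n), (∀ n, MeasurableSet (A n)) ∧
      S i ⊆ internalSet 𝔲 ν A ∧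
      limUnder (𝔲 : Filter ℕ) (fun n => ν n (A n)) < loebContent 𝔲 ν (S i) + δ i := by
    intro i
    have hi : loebContent 𝔲 ν (S i) < loebContent 𝔲 ν (S i) + δ i :=
      ENNReal.lt_add_right ((ENNReal.le_tsum i).trans_lt hfin).ne
        (ENNReal.coe_pos.2 (hδ i)).ne'
    conv_lhs at hi => unfold loebContent
    simpa only [iInf_lt_iff, exists_prop] using hi
  choose A hAm hSA hlim using hA
  have hev : ∀ k, ∀ᶠ n in (𝔲 : Filter ℕ), ∀ i < k,
      ν n (A i n) ≤ loebContent 𝔲 ν (S i) + δ i := fun k =>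
    (eventually_all_finite (Set.finite_Iio k)).2 fun i _ =>
      ((tendsto_limUnder_ultrafilter 𝔲 _).eventually (gt_mem_nhds (hlim i))).mono
        fun n hn => le_of_lt hn
  obtain ⟨k, hk, hkp⟩ := exists_tendsto_atTop_of_forall_eventually h𝔲 hev
  refine (loebContent_le (A := fun n => ⋃ i ∈ Finset.range (k n), A i n)
    (c := ∑' i, (loebContent 𝔲 ν (S i) + δ i)) (fun n => ?_) ?_ ?_).trans ?_
  · exact Finset.measurableSet_biUnion _ fun i _ => hAm i n
  · refine iUnion_subset fun i x hx => ?_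
    obtain ⟨a, rfl⟩ := LoebSpace.mk_surjective x
    rw [mk_mem_internalSet]
    filter_upwards [mk_mem_internalSet.1 (hSA i hx), hk.eventually_gt_atTop i] with n h1 h2
    exact mem_biUnion (Finset.mem_coe.2 (Finset.mem_range.2 h2)) h1
  · filter_upwards [hkp] with n hn
    calc ν n (⋃ i ∈ Finset.range (k n), A i n)
        ≤ ∑ i ∈ Finset.range (k n), ν n (A i n) := measure_biUnion_finset_le _ _
      _ ≤ ∑ i ∈ Finset.range (k n), (loebContent 𝔲 ν (S i) + δ i) :=
          Finset.sum_le_sum fun i hi => hn i (Finset.mem_range.1 hi)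
      _ ≤ _ := ENNReal.sum_le_tsum _
  · rw [ENNReal.tsum_add]
    gcongr

/-- The Loeb content is already an outer measure. -/
theorem loebOuter_apply (h𝔲 : (𝔲 : Filter ℕ) ≤ cofinite) (S : Set (LoebSpace 𝔲 ν)) :
    loebOuter 𝔲 ν S = loebContent 𝔲 ν S :=
  OuterMeasure.ofFunction_eq S (fun _ h => loebContent_mono h) (loebContent_iUnion_le h𝔲)

theorem loebOuter_le {S : Set (LoebSpace 𝔲 ν)} {A : ∀ n, Set (Y n)}
    (hA : ∀ n, MeasurableSet (A n)) (hS : S ⊆ internalSet 𝔲 ν A) {c : ℝ≥0∞}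
    (hc : ∀ᶠ n in (𝔲 : Filter ℕ), ν n (A n) ≤ c) : loebOuter 𝔲 ν S ≤ c :=
  (OuterMeasure.ofFunction_le S).trans (loebContent_le hA hS hc)

theorem loebOuter_eq_zero {S : Set (LoebSpace 𝔲 ν)} {A : ∀ n, Set (Y n)}
    (hA : ∀ n, MeasurableSet (A n)) (hS : S ⊆ internalSet 𝔲 ν A)
    (hc : Tendsto (fun n => ν n (A n)) 𝔲 (𝓝 0)) : loebOuter 𝔲 ν S = 0 := by
  refine le_antisymm (ENNReal.le_of_forall_pos_le_add fun ε hε _ => ?_) bot_le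
  rw [zero_add]
  exact loebOuter_le hA hS (hc.eventually (ge_mem_nhds (ENNReal.coe_pos.2 hε)))

theorem measurableSet_internalSet (h𝔲 : (𝔲 : Filter ℕ) ≤ cofinite) {A : ∀ n, Set (Y n)}
    (hA : ∀ n, MeasurableSet (A n)) : MeasurableSet (internalSet 𝔲 ν A) := by
  refine (OuterMeasure.isCaratheodory_iff_le' _).2 fun S => ?_
  simp only [loebOuter_apply h𝔲]
  refine le_iInf fun B => le_iInf fun hB => le_iInf fun hS => ?_
  have h1 := tendsto_limUnder_ultrafilter 𝔲 (fun n => ν n (B n ∩ A n))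
  have h2 := tendsto_limUnder_ultrafilter 𝔲 (fun n => ν n (B n \ A n))
  have h3 := tendsto_limUnder_ultrafilter 𝔲 (fun n => ν n (B n))
  have h4 := tendsto_nhds_unique (h1.add h2)
    (h3.congr fun n => (measure_inter_add_sdiff (B n) (hA n)).symm)
  rw [← h4]
  refine add_le_add ?_ ?_
  · refine iInf_le_of_le _ (iInf_le_of_le (fun n => (hB n).inter (hA n)) (iInf_le _ ?_))
    rintro x ⟨hx, hxA⟩
    obtain ⟨a, rfl⟩ := LoebSpace.mk_surjective x
    exact mk_mem_internalSet.2
      ((mk_mem_internalSet.1 (hS hx)).and (mk_mem_internalSet.1 hxA))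
  · refine iInf_le_of_le _ (iInf_le_of_le (fun n => (hB n).diff (hA n)) (iInf_le _ ?_))
    rintro x ⟨hx, hxA⟩
    obtain ⟨a, rfl⟩ := LoebSpace.mk_surjective x
    rw [mk_mem_internalSet, ← Ultrafilter.eventually_not] at hxA
    exact mk_mem_internalSet.2 ((mk_mem_internalSet.1 (hS hx)).and hxA)

end LoebTheory

/-! ### Partial automorphisms from relations -/

section Rel

variable {Y : Type*}

/-- The set of the points related by `r` to some point of `B`. -/
def relPreimage (r : Y → Y → Prop) (B : Set Y) : Set Y := {y | ∃ y' ∈ B, r y y'}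

theorem relPreimage_mono {r : Y → Y → Prop} {B C : Set Y} (h : B ⊆ C) :
    relPreimage r B ⊆ relPreimage r C := fun _ ⟨y', hy', hr⟩ => ⟨y', h hy', hr⟩

/-- A relation that is injective and single-valued is the graph of a partial equivalence. -/
theorem exists_partialEquiv_of_biUnique {r : Y → Y → Prop} (hr : Relator.BiUnique r) :
    ∃ φ : PartialEquiv Y Y, (∀ y y', (y ∈ φ.source ∧ φ y = y') ↔ r y y') ∧
      φ.source = relPreimage r univ ∧ φ.target = relPreimage (Function.swap r) univ ∧
      (∀ B, φ.source ∩ φ ⁻¹' B = relPreimage r B) ∧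
      ∀ B, φ.target ∩ φ.symm ⁻¹' B = relPreimage (Function.swap r) B := by
  classical
  obtain ⟨hl, hrr⟩ := hr
  let f : Y → Y := fun y => if h : ∃ y', r y y' then h.choose else y
  let f' : Y → Y := fun y => if h : ∃ y', r y' y then h.choose else y
  have hf : ∀ y y', r y y' → f y = y' := by
    intro y y' h
    have h' : ∃ y', r y y' := ⟨y', h⟩
    simp only [f, dif_pos h']
    exact hrr h'.choose_spec h
  have hf' : ∀ y y', r y y' → f' y' = y := by
    intro y y' h
    have h' : ∃ y, r y y' := ⟨y, h⟩
    simp only [f', dif_pos h']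
    exact hl h'.choose_spec h
  refine ⟨⟨f, f', relPreimage r univ, relPreimage (Function.swap r) univ, ?_, ?_, ?_, ?_⟩,
    ?_, rfl, rfl, ?_, ?_⟩
  · rintro y ⟨y', -, h⟩
    exact ⟨y, trivial, by rw [hf _ _ h]; exact h⟩
  · rintro y' ⟨y, -, h⟩
    exact ⟨y', trivial, by rw [hf' _ _ h]; exact h⟩
  · rintro y ⟨y', -, h⟩
    rw [hf _ _ h, hf' _ _ h]
  · rintro y' ⟨y, -, h⟩
    rw [hf' _ _ h, hf _ _ h]
  · intro y y'
    constructor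
    · rintro ⟨⟨z, -, h⟩, rfl⟩
      change r y (f y)
      rwa [hf _ _ h]
    · exact fun h => ⟨⟨y', trivial, h⟩, hf _ _ h⟩
  · intro B
    ext y
    constructor
    · rintro ⟨⟨z, -, h⟩, hB⟩
      change f y ∈ B at hB
      rw [hf _ _ h] at hB
      exact ⟨z, hB, h⟩
    · rintro ⟨z, hB, h⟩
      refine ⟨⟨z, trivial, h⟩, ?_⟩
      change f y ∈ B
      rwa [hf _ _ h]
  · intro B
    ext y
    constructor
    · rintro ⟨⟨z, -, h⟩, hB⟩
      change f' y ∈ B at hB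
      rw [hf' _ _ h] at hB
      exact ⟨z, hB, h⟩
    · rintro ⟨z, hB, h⟩
      refine ⟨⟨z, trivial, h⟩, ?_⟩
      change f' y ∈ B
      rwa [hf' _ _ h]

theorem exists_partialAut_of_biUnique [MeasurableSpace Y] {ν : Measure Y} {r : Y → Y → Prop}
    (hr : Relator.BiUnique r)
    (hm : ∀ B, MeasurableSet B → MeasurableSet (relPreimage r B))
    (hm' : ∀ B, MeasurableSet B → MeasurableSet (relPreimage (Function.swap r) B))
    (hν : ∀ B ⊆ relPreimage (Function.swap r) univ, MeasurableSet B → ν (relPreimage r B) = ν B) :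
    ∃ φ : PartialAut ν, ∀ y y', φ.graph y y' ↔ r y y' := by
  obtain ⟨φ, hφ, hs, ht, hpre, hpre'⟩ := exists_partialEquiv_of_biUnique hr
  exact ⟨{ φ with
    measurableSet_source := hs ▸ hm _ MeasurableSet.univ
    measurableSet_target := ht ▸ hm' _ MeasurableSet.univ
    measurable_toFun := fun B hB => (hpre B).symm ▸ hm B hB
    measurable_invFun := fun B hB => (hpre' B).symm ▸ hm' B hB
    measure_preserving := fun B hBt hB => by
      rw [show φ.source ∩ φ.toFun ⁻¹' B = relPreimage r B from hpre B]
      exact hν B (ht ▸ hBt) hB }, hφ⟩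

/-- A relation which does not increase the outer measure, in either direction, transports
Carathéodory measurable sets to such sets. -/
theorem isCaratheodory_relPreimage {m : OuterMeasure Y} {r : Y → Y → Prop}
    (h : ∀ S, m (relPreimage r S) ≤ m S) (h' : ∀ S, m (relPreimage (Function.swap r) S) ≤ m S)
    (hdom : m.IsCaratheodory (relPreimage r univ)) {B : Set Y} (hB : m.IsCaratheodory B) :
    m.IsCaratheodory (relPreimage r B) := by
  refine (OuterMeasure.isCaratheodory_iff_le' _).2 fun T => ?_
  set D := relPreimage r univ
  have key : m ((T ∩ D) ∩ relPreimage r B) + m ((T ∩ D) \ relPreimage r B) ≤ m (T ∩ D) := by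
    set J := relPreimage (Function.swap r) (T ∩ D)
    calc m ((T ∩ D) ∩ relPreimage r B) + m ((T ∩ D) \ relPreimage r B)
        ≤ m (relPreimage r (J ∩ B)) + m (relPreimage r (J \ B)) := by
          refine add_le_add (m.mono ?_) (m.mono ?_)
          · rintro y ⟨hy, y', hy', hrr⟩
            exact ⟨y', ⟨⟨y, hy, hrr⟩, hy'⟩, hrr⟩
          · rintro y ⟨hy, hyB⟩
            obtain ⟨y', -, hrr⟩ := hy.2
            exact ⟨y', ⟨⟨y, hy, hrr⟩, fun hB => hyB ⟨y', hB, hrr⟩⟩, hrr⟩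
      _ ≤ m (J ∩ B) + m (J \ B) := add_le_add (h _) (h _)
      _ = m J := (hB J).symm
      _ ≤ m (T ∩ D) := h' _
  calc m (T ∩ relPreimage r B) + m (T \ relPreimage r B)
      ≤ m ((T ∩ D) ∩ relPreimage r B) + (m ((T ∩ D) \ relPreimage r B) + m (T \ D)) := by
        refine add_le_add (m.mono ?_) ((m.mono ?_).trans (measure_union_le _ _))
        · exact fun y hy => ⟨⟨hy.1, relPreimage_mono (subset_univ _) hy.2⟩, hy.2⟩
        · intro y hy
          by_cases hD : y ∈ D
          · exact Or.inl ⟨⟨hy.1, hD⟩, hy.2⟩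
          · exact Or.inr ⟨hy.1, hD⟩
    _ ≤ m (T ∩ D) + m (T \ D) := by rw [← add_assoc]; gcongr
    _ = m T := (hdom T).symm

/-- A relation which does not increase the outer measure, in either direction, is a partial
automorphism of the Carathéodory measure space. -/
theorem exists_partialAut_of_outerMeasure {m : OuterMeasure Y} {r : Y → Y → Prop}
    (hr : Relator.BiUnique r)
    (h : ∀ S, m (relPreimage r S) ≤ m S) (h' : ∀ S, m (relPreimage (Function.swap r) S) ≤ m S)
    (hdom : m.IsCaratheodory (relPreimage r univ))
    (hran : m.IsCaratheodory (relPreimage (Function.swap r) univ)) :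
    ∃ φ : @PartialAut Y m.caratheodory (@OuterMeasure.toMeasure Y m.caratheodory m le_rfl),
      ∀ y y', @PartialAut.graph Y m.caratheodory _ φ y y' ↔ r y y' := by
  let := m.caratheodory
  have hmeas : ∀ B, MeasurableSet B → MeasurableSet (relPreimage r B) := fun B hB =>
    isCaratheodory_relPreimage h h' hdom hB
  refine exists_partialAut_of_biUnique hr hmeas
    (fun B hB => isCaratheodory_relPreimage h' h hran hB) fun B hBt hB => ?_
  rw [toMeasure_apply _ _ (hmeas B hB), toMeasure_apply _ _ hB]
  refine le_antisymm (h B) ((m.mono ?_).trans (h' (relPreimage r B)))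
  intro y' hy'
  obtain ⟨y, -, hy⟩ := hBt hy'
  exact ⟨y, ⟨y', hy', hy⟩, hy⟩

end Rel

/-! ### Covering by translates -/

section Group

variable {G : Type*} [Group G] [TopologicalSpace G] [IsTopologicalGroup G]

/-- A locally compact group is complete for its right uniformity. -/
theorem polishSpace_of_locallyCompact_group [T2Space G] [LocallyCompactSpace G]
    [SecondCountableTopology G] : PolishSpace G := by
  let := IsTopologicalGroup.rightUniformSpace G
  have : IsRightUniformGroup G := { ‹IsTopologicalGroup G› with uniformity_eq := rfl }
  have : (uniformity G).IsCountablyGenerated := comap.isCountablyGenerated _ _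
  have : CompleteSpace G := IsRightUniformGroup.completeSpace_of_weaklyLocallyCompactSpace
  infer_instance

theorem exists_seq_iUnion_smul_eq_univ [SecondCountableTopology G] {U : Set G} (hU : U ∈ 𝓝 (1 : G)) :
    ∃ g : ℕ → G, ⋃ i, g i • U = univ := by
  refine ⟨TopologicalSpace.denseSeq G, eq_univ_of_forall fun x => ?_⟩
  have hx : {z : G | z⁻¹ * x ∈ U} ∈ 𝓝 x := by
    have h : Tendsto (fun z : G => z⁻¹ * x) (𝓝 x) (𝓝 1) := by
      have : Continuous fun z : G => z⁻¹ * x := by fun_prop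
      simpa using this.tendsto x
    exact h hU
  obtain ⟨_, ⟨i, rfl⟩, hz⟩ := (TopologicalSpace.denseRange_denseSeq G).inter_nhds_nonempty hx
  exact mem_iUnion.2 ⟨i, mem_smul_set_iff_inv_smul_mem.2 hz⟩

theorem exists_finset_subset_biUnion_smul {C U : Set G} (hC : IsCompact C) (hU : U ∈ 𝓝 (1 : G)) :
    ∃ t : Finset G, C ⊆ ⋃ g ∈ t, g • U := by
  obtain ⟨t, -, ht⟩ := hC.elim_nhds_subcover (fun g => g • U) fun g _ => by
    simpa using (smul_mem_nhds_smul g hU)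
  exact ⟨t, ht⟩

theorem exists_forall_measure_smul_le [MeasurableSpace G] {C U : Set G} (hC : IsCompact C)
    (hU : U ∈ 𝓝 (1 : G)) : ∃ N : ℕ, ∀ {X : Type*} [MeasurableSpace X] [MulAction G X]
      (μ : Measure X) [MeasurableConstSMul G X] [SMulInvariantMeasure G X μ] (B : Set X),
      μ (C • B) ≤ N * μ (U • B) := by
  obtain ⟨t, ht⟩ := exists_finset_subset_biUnion_smul hC hU
  refine ⟨t.card, fun {X} _ _ μ _ _ B => ?_⟩
  calc μ (C • B) ≤ μ (⋃ g ∈ t, g • (U • B)) := by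
        refine measure_mono ?_
        rintro _ ⟨c, hc, b, hb, rfl⟩
        obtain ⟨g, hg, u, hu, rfl⟩ := mem_iUnion₂.1 (ht hc)
        exact mem_iUnion₂.2 ⟨g, hg, u • b, ⟨u, hu, b, hb, rfl⟩, by simp [mul_smul]⟩
    _ ≤ ∑ g ∈ t, μ (g • (U • B)) := measure_biUnion_finset_le _ _
    _ = t.card * μ (U • B) := by simp [measure_smul]

end Group

/-! ### Edges and slices of a cross section -/

section Algebra

variable {G : Type*} [Group G] {X : Type*} [MulAction G X] {Y : Set X}

theorem swap_crossEdge {Z : Type*} (Ψ : G → Z → X) (S : Set G) :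
    Function.swap (crossEdge Ψ S) = crossEdge Ψ S⁻¹ := by
  funext y y'
  refine propext ⟨?_, ?_⟩
  · rintro ⟨k, hk, h⟩
    exact ⟨k⁻¹, by simpa using hk, by rw [← h, inv_smul_smul]⟩
  · rintro ⟨k, hk, h⟩
    exact ⟨k⁻¹, hk, by rw [← h, inv_smul_smul]⟩

theorem crossEdge_actPsi {S : Set G} {y y' : Y} :
    crossEdge (actPsi Y) S y y' ↔ ∃ k ∈ S, k • (y : X) = y' := by
  simp [crossEdge, actPsi]

/-- The action map restricted to `G × Y`. -/
def actMap (G : Type*) [Group G] {X : Type*} [MulAction G X] (Y : Set X) (p : G × Y) : X :=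
  p.1 • (p.2 : X)

theorem image_actMap_prod (S : Set G) (B : Set Y) :
    actMap G Y '' (S ×ˢ B) = S • (Subtype.val '' B : Set X) := by
  ext x
  constructor
  · rintro ⟨⟨s, b⟩, ⟨hs, hb⟩, rfl⟩
    exact ⟨s, hs, b, ⟨b, hb, rfl⟩, rfl⟩
  · rintro ⟨s, hs, _, ⟨b, hb, rfl⟩, rfl⟩
    exact ⟨(s, b), ⟨hs, hb⟩, rfl⟩

theorem measurable_actMap [MeasurableSpace G] [MeasurableSpace X] [MeasurableSMul₂ G X] :
    Measurable (actMap G Y) :=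
  measurable_fst.smul (measurable_subtype_coe.comp measurable_snd)

end Algebra

section CrossSection

variable {G : Type*} [Group G] {X : Type*} [MeasurableSpace X] [MulAction G X] {μ : Measure X}
  {U' : Set G} {Y : Set X}

theorem IsCrossSection.eq_and_eq (hY : IsCrossSection μ U' Y) {u v : G} {y z : X} (hu : u ∈ U')
    (hv : v ∈ U') (hy : y ∈ Y) (hz : z ∈ Y) (h : u • y = v • z) : u = v ∧ y = z := by
  have := hY.injOn (show (u, y) ∈ U' ×ˢ Y from ⟨hu, hy⟩) (show (v, z) ∈ U' ×ˢ Y from ⟨hv, hz⟩) h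
  exact Prod.mk_inj.1 this

/-- The action is injective on `g U' × Y`. -/
theorem IsCrossSection.eq_and_eq_of_translate (hY : IsCrossSection μ U' Y) {g u v : G} {y z : X}
    (hu : g⁻¹ * u ∈ U') (hv : g⁻¹ * v ∈ U') (hy : y ∈ Y) (hz : z ∈ Y) (h : u • y = v • z) :
    u = v ∧ y = z := by
  have := hY.eq_and_eq hu hv hy hz (by rw [mul_smul, mul_smul, h])
  exact ⟨mul_left_cancel this.1, this.2⟩

/-- The sets `S ⊆ G` for which `Θ^S` is the graph of a partial bijection: `g⁻¹ S ⊆ U'` makes it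
injective and `g S⁻¹ ⊆ U'` makes it single-valued. The condition is symmetric under
`(g, S) ↦ (g⁻¹, S⁻¹)`, and holds for the sets `V_j⁻¹ g_j` of a graphing code. -/
def IsSliceSet (U' S : Set G) : Prop := ∃ g : G, ∀ k ∈ S, g * k⁻¹ ∈ U' ∧ g⁻¹ * k ∈ U'

theorem IsSliceSet.inv {S : Set G} (hS : IsSliceSet U' S) : IsSliceSet U' S⁻¹ := by
  obtain ⟨g, hg⟩ := hS
  exact ⟨g⁻¹, fun k hk => by simpa [and_comm] using hg k⁻¹ hk⟩

theorem IsCrossSection.leftUnique_crossEdge (hY : IsCrossSection μ U' Y) {S : Set G}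
    (hS : IsSliceSet U' S) : Relator.LeftUnique (crossEdge (actPsi (G := G) Y) S) := by
  obtain ⟨g, hg⟩ := hS
  intro y z y' h1 h2
  obtain ⟨k, hk, h1⟩ := crossEdge_actPsi.1 h1
  obtain ⟨k', hk', h2⟩ := crossEdge_actPsi.1 h2
  exact Subtype.ext
    (hY.eq_and_eq_of_translate (hg k hk).2 (hg k' hk').2 y.2 z.2 (h1.trans h2.symm)).2

theorem IsCrossSection.biUnique_crossEdge (hY : IsCrossSection μ U' Y) {S : Set G}
    (hS : IsSliceSet U' S) : Relator.BiUnique (crossEdge (actPsi (G := G) Y) S) := by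
  refine ⟨hY.leftUnique_crossEdge hS, fun y y' z h1 h2 => ?_⟩
  have h := hY.leftUnique_crossEdge hS.inv
  rw [← swap_crossEdge] at h
  exact h h1 h2

theorem IsCrossSection.injOn_actMap (hY : IsCrossSection μ U' Y) (g : G) :
    InjOn (actMap G Y) ((g • U') ×ˢ univ) := by
  rintro ⟨s, y⟩ ⟨hs, -⟩ ⟨t, z⟩ ⟨ht, -⟩ h
  have := hY.eq_and_eq_of_translate (mem_smul_set_iff_inv_smul_mem.1 hs)
    (mem_smul_set_iff_inv_smul_mem.1 ht) y.2 z.2 h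
  exact Prod.ext this.1 (Subtype.ext this.2)

end CrossSection

/-! ### Borel sets and the measure of a cross section -/

section Measure

variable {G : Type*} [Group G] [TopologicalSpace G] [IsTopologicalGroup G] [T2Space G]
  [LocallyCompactSpace G] [SecondCountableTopology G] [MeasurableSpace G] [BorelSpace G]
  {X : Type*} [MeasurableSpace X] [StandardBorelSpace X] [MulAction G X] [MeasurableSMul₂ G X]
  {μ : Measure X} {U' : Set G} {Y : Set X}

theorem IsCrossSection.measurableSet_image_actMap (hY : IsCrossSection μ U' Y) {T : Set (G × Y)}
    (hT : MeasurableSet T) (hinj : InjOn (actMap G Y) T) : MeasurableSet (actMap G Y '' T) := by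
  have := polishSpace_of_locallyCompact_group (G := G)
  have := hY.measurableSet.standardBorel
  exact hT.image_of_measurable_injOn measurable_actMap hinj

theorem IsCrossSection.measurableSet_smul (hY : IsCrossSection μ U' Y) (hU'o : IsOpen U')
    (hU'1 : (1 : G) ∈ U') {S : Set G} (hS : MeasurableSet S) {B : Set Y} (hB : MeasurableSet B) :
    MeasurableSet (S • (Subtype.val '' B : Set X)) := by
  obtain ⟨g, hg⟩ := exists_seq_iUnion_smul_eq_univ (hU'o.mem_nhds hU'1)
  rw [← image_actMap_prod]
  have : S ×ˢ B = ⋃ i, (S ∩ g i • U') ×ˢ B := by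
    rw [← iUnion_prod_const, ← inter_iUnion, hg, inter_univ]
  rw [this, image_iUnion]
  refine MeasurableSet.iUnion fun i => hY.measurableSet_image_actMap
    ((hS.inter (hU'o.smul (g i)).measurableSet).prod hB)
    ((hY.injOn_actMap (g i)).mono (prod_mono inter_subset_right (subset_univ _)))

theorem IsCrossSection.measurableSet_relPreimage (hY : IsCrossSection μ U' Y) (hU'o : IsOpen U')
    (hU'1 : (1 : G) ∈ U') {S : Set G} (hS : MeasurableSet S) {B : Set Y} (hB : MeasurableSet B) :
    MeasurableSet (relPreimage (crossEdge (actPsi Y) S) B) := by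
  have : relPreimage (crossEdge (actPsi Y) S) B =
      Subtype.val ⁻¹' (S⁻¹ • (Subtype.val '' B : Set X)) := by
    ext y
    constructor
    · rintro ⟨y', hy', h⟩
      obtain ⟨k, hk, h⟩ := crossEdge_actPsi.1 h
      exact ⟨k⁻¹, by simpa using hk, y', ⟨y', hy', rfl⟩, by simp [← h]⟩
    · rintro ⟨k, hk, _, ⟨y', hy', rfl⟩, h⟩
      exact ⟨y', hy', crossEdge_actPsi.2 ⟨k⁻¹, hk, by simp [← h]⟩⟩
  rw [this]
  exact measurable_subtype_coe (hY.measurableSet_smul hU'o hU'1 hS.inv hB)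

theorem IsCrossSection.crossMeasure_apply (hY : IsCrossSection μ U' Y) (hU'o : IsOpen U')
    {B : Set Y} (hB : MeasurableSet B) :
    crossMeasure μ U' Y B = (μ (U' • Y))⁻¹ * μ (U' • (Subtype.val '' B : Set X)) := by
  have := polishSpace_of_locallyCompact_group (G := G)
  have := hY.measurableSet.standardBorel
  have := hU'o.measurableSet.standardBorel
  have hemb : MeasurableEmbedding (fun p : U' × Y => (p.1 : G) • (p.2 : X)) := by
    refine Measurable.measurableEmbedding ?_ ?_
    · exact (measurable_subtype_coe.comp measurable_fst).smul
        (measurable_subtype_coe.comp measurable_snd)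
    · rintro ⟨s, y⟩ ⟨t, z⟩ h
      have := hY.eq_and_eq s.2 t.2 y.2 z.2 h
      exact Prod.ext (Subtype.ext this.1) (Subtype.ext this.2)
  rw [crossMeasure, Measure.smul_apply, smul_eq_mul, Measure.map_apply measurable_snd hB,
    hemb.comap_apply]
  congr 2
  ext x
  constructor
  · rintro ⟨⟨s, b⟩, hb, rfl⟩
    exact ⟨s, s.2, b, ⟨b, hb, rfl⟩, rfl⟩
  · rintro ⟨s, hs, _, ⟨b, hb, rfl⟩, rfl⟩
    exact ⟨(⟨s, hs⟩, b), hb, rfl⟩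

variable [SMulInvariantMeasure G X μ]

omit [T2Space G] [LocallyCompactSpace G] [MeasurableSpace G] [BorelSpace G]
  [StandardBorelSpace X] [MeasurableSMul₂ G X] in
theorem IsCrossSection.measure_smul_ne_zero [IsProbabilityMeasure μ] (hY : IsCrossSection μ U' Y)
    (hU'o : IsOpen U') (hU'1 : (1 : G) ∈ U') : μ (U' • Y) ≠ 0 := by
  obtain ⟨g, hg⟩ := exists_seq_iUnion_smul_eq_univ (hU'o.mem_nhds hU'1)
  intro h
  have h1 : μ ((univ : Set G) • Y) = 0 := by
    rw [← hg, iUnion_smul, measure_iUnion_null_iff]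
    intro i
    rw [smul_assoc, measure_smul, h]
  have h2 : μ (univ : Set X) ≤ μ ((univ : Set G) • Y) + μ ((univ : Set G) • Y)ᶜ := by
    rw [← union_compl_self ((univ : Set G) • Y)]
    exact measure_union_le _ _
  rw [h1, hY.conull, measure_univ] at h2
  simp at h2

theorem IsCrossSection.isProbabilityMeasure [IsProbabilityMeasure μ] (hY : IsCrossSection μ U' Y)
    (hU'o : IsOpen U') (hU'1 : (1 : G) ∈ U') : IsProbabilityMeasure (crossMeasure μ U' Y) := by
  refine ⟨?_⟩
  rw [hY.crossMeasure_apply hU'o MeasurableSet.univ, image_univ, Subtype.range_coe]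
  exact ENNReal.inv_mul_cancel (hY.measure_smul_ne_zero hU'o hU'1) (measure_ne_top _ _)

end Measure

/-! ### The orbit measure on `G × Y` -/

section OrbitMeasure

variable {G : Type*} [Group G] [TopologicalSpace G] [IsTopologicalGroup G] [T2Space G]
  [LocallyCompactSpace G] [SecondCountableTopology G] [MeasurableSpace G] [BorelSpace G]
  {X : Type*} [MeasurableSpace X] [StandardBorelSpace X] [MulAction G X] [MeasurableSMul₂ G X]
  {μ : Measure X} {U' : Set G} {Y : Set X}

theorem exists_partition_subset_smul {G : Type*} [Group G] [TopologicalSpace G]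
    [IsTopologicalGroup G] [SecondCountableTopology G] [MeasurableSpace G] [BorelSpace G]
    {U' : Set G} (hU'o : IsOpen U') (hU'1 : (1 : G) ∈ U') :
    ∃ D : ℕ → Set G, (∀ i, MeasurableSet (D i)) ∧ Pairwise (Function.onFun Disjoint D) ∧
      ⋃ i, D i = univ ∧ ∀ i, ∃ g : G, D i ⊆ g • U' := by
  obtain ⟨g, hg⟩ := exists_seq_iUnion_smul_eq_univ (hU'o.mem_nhds hU'1)
  exact ⟨disjointed fun i => g i • U',
    MeasurableSet.disjointed fun i => (hU'o.smul (g i)).measurableSet,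
    disjoint_disjointed _, by rw [iUnion_disjointed, hg], fun i => ⟨g i, disjointed_subset _ i⟩⟩

/-- The measure on `G × Y` which counts, above each point of `X`, the preimages under the action
map; equivalently the one for which the action map is measure preserving wherever it is
injective. -/
theorem IsCrossSection.exists_orbitMeasure (hY : IsCrossSection μ U' Y) (hU'o : IsOpen U')
    (hU'1 : (1 : G) ∈ U') : ∃ M : Measure (G × Y), ∀ T, MeasurableSet T →
      InjOn (actMap G Y) T → M T = μ (actMap G Y '' T) := by
  have := polishSpace_of_locallyCompact_group (G := G)
  have := hY.measurableSet.standardBorel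
  obtain ⟨D, hDm, hDd, hDu, hDs⟩ := exists_partition_subset_smul hU'o hU'1
  have hPm : ∀ i, MeasurableSet (D i ×ˢ univ : Set (G × Y)) := fun i =>
    (hDm i).prod MeasurableSet.univ
  have hPinj : ∀ i, InjOn (actMap G Y) (D i ×ˢ univ) := fun i => by
    obtain ⟨g, hg⟩ := hDs i
    exact (hY.injOn_actMap g).mono (prod_mono hg Subset.rfl)
  have hemb : ∀ i, MeasurableEmbedding
      (fun p : (D i ×ˢ univ : Set (G × Y)) => actMap G Y p.1) := fun i => by
    have := (hPm i).standardBorel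
    exact (measurable_actMap.comp measurable_subtype_coe).measurableEmbedding
      (injOn_iff_injective.1 (hPinj i))
  refine ⟨Measure.sum fun i => (μ.comap
    (fun p : (D i ×ˢ univ : Set (G × Y)) => actMap G Y p.1)).map Subtype.val, fun T hT hinj => ?_⟩
  have himg : actMap G Y '' T = ⋃ i, actMap G Y '' (T ∩ D i ×ˢ univ) := by
    rw [← image_iUnion, ← inter_iUnion, ← iUnion_prod_const, hDu, univ_prod_univ, inter_univ]
  rw [Measure.sum_apply _ hT, himg, measure_iUnion]
  · refine tsum_congr fun i => ?_
    rw [Measure.map_apply measurable_subtype_coe hT, (hemb i).comap_apply]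
    congr 1
    ext x
    constructor
    · rintro ⟨p, hp, rfl⟩
      exact ⟨p, ⟨hp, p.2⟩, rfl⟩
    · rintro ⟨p, ⟨hp, hp'⟩, rfl⟩
      exact ⟨⟨p, hp'⟩, hp, rfl⟩
  · intro i j hij
    refine disjoint_left.2 ?_
    rintro _ ⟨p, ⟨hpT, hpi⟩, rfl⟩ ⟨q, ⟨hqT, hqj⟩, hpq⟩
    obtain rfl := hinj hqT hpT hpq
    exact disjoint_left.1 (hDd hij) hpi.1 hqj.1
  · exact fun i => hY.measurableSet_image_actMap (hT.inter (hPm i)) (hinj.mono inter_subset_left)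

variable [SMulInvariantMeasure G X μ]

omit [T2Space G] [LocallyCompactSpace G] [StandardBorelSpace X] [MeasurableSMul₂ G X] in
/-- The orbit measure is left invariant, as it can be computed from any countable Borel partition
into sets on which the action map is injective, such as the translate of a given one. -/
theorem IsCrossSection.orbitMeasure_preimage_mul (hY : IsCrossSection μ U' Y) (hU'o : IsOpen U')
    (hU'1 : (1 : G) ∈ U') {M : Measure (G × Y)}
    (hM : ∀ T, MeasurableSet T → InjOn (actMap G Y) T → M T = μ (actMap G Y '' T))
    (h : G) {T : Set (G × Y)} (hT : MeasurableSet T) :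
    M ((fun p : G × Y => (h * p.1, p.2)) ⁻¹' T) = M T := by
  obtain ⟨D, hDm, hDd, hDu, hDs⟩ := exists_partition_subset_smul hU'o hU'1
  have hsm : Measurable (fun p : G × Y => (h * p.1, p.2)) :=
    (measurable_fst.const_mul h).prodMk measurable_snd
  have hsm' : Measurable (fun p : G × Y => (h⁻¹ * p.1, p.2)) :=
    (measurable_fst.const_mul h⁻¹).prodMk measurable_snd
  set P : ℕ → Set (G × Y) := fun i => D i ×ˢ univ with hP
  have hPm : ∀ i, MeasurableSet (P i) := fun i => (hDm i).prod MeasurableSet.univ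
  have hPinj : ∀ i, InjOn (actMap G Y) (P i) := fun i => by
    obtain ⟨g, hg⟩ := hDs i
    exact (hY.injOn_actMap g).mono (prod_mono hg Subset.rfl)
  have hPd : Pairwise (Function.onFun Disjoint P) := fun i j hij =>
    disjoint_left.2 fun p hp hq => disjoint_left.1 (hDd hij) hp.1 hq.1
  have hPu : ⋃ i, P i = univ := by rw [← iUnion_prod_const, hDu, univ_prod_univ]
  set s : G × Y → G × Y := fun p => (h * p.1, p.2)
  set s' : G × Y → G × Y := fun p => (h⁻¹ * p.1, p.2)
  have hss' : ∀ p, s (s' p) = p := fun p => by simp [s, s']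
  have hs's : ∀ p, s' (s p) = p := fun p => by simp [s, s']
  have hact : ∀ p, actMap G Y (s p) = h • actMap G Y p := fun p => mul_smul _ _ _
  have key : ∀ i, M (s ⁻¹' T ∩ P i) = M (T ∩ s' ⁻¹' P i) := by
    intro i
    have himg : actMap G Y '' (T ∩ s' ⁻¹' P i) = h • (actMap G Y '' (s ⁻¹' T ∩ P i)) := by
      ext x
      constructor
      · rintro ⟨p, ⟨hpT, hp⟩, rfl⟩
        refine ⟨_, ⟨s' p, ⟨?_, hp⟩, rfl⟩, ?_⟩
        · change s (s' p) ∈ T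
          rwa [hss']
        · change h • actMap G Y (s' p) = _
          rw [← hact, hss']
      · rintro ⟨_, ⟨p, ⟨hpT, hp⟩, rfl⟩, rfl⟩
        refine ⟨s p, ⟨hpT, ?_⟩, hact p⟩
        change s' (s p) ∈ P i
        rwa [hs's]
    rw [hM _ ((hsm hT).inter (hPm i)) ((hPinj i).mono inter_subset_right),
      hM _ (hT.inter (hsm' (hPm i))), himg, measure_smul]
    rintro p ⟨-, hp⟩ q ⟨-, hq⟩ hpq
    have : actMap G Y (s' p) = actMap G Y (s' q) := by
      apply MulAction.injective h
      change h • _ = h • _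
      rw [← hact, ← hact, hss', hss', hpq]
    rw [← hss' p, hPinj i hp hq this, hss']
  have e1 : s ⁻¹' T = ⋃ i, s ⁻¹' T ∩ P i := by rw [← inter_iUnion, hPu, inter_univ]
  have e2 : T = ⋃ i, T ∩ s' ⁻¹' P i := by
    rw [← inter_iUnion, ← preimage_iUnion, hPu, preimage_univ, inter_univ]
  rw [e1, measure_iUnion (fun i j hij => (hPd hij).mono inter_subset_right inter_subset_right)
    (fun i => (hsm hT).inter (hPm i))]
  conv_rhs => rw [e2]
  rw [measure_iUnion (fun i j hij => ((hPd hij).preimage s').mono inter_subset_right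
    inter_subset_right) (fun i => hT.inter (hsm' (hPm i)))]
  exact tsum_congr key

/-- The orbit measure is the product of the Haar measure and the measure of the cross section, up
to the factor `covol(Y)⁻¹`. -/
theorem IsCrossSection.orbitMeasure_eq_prod [IsProbabilityMeasure μ] (hY : IsCrossSection μ U' Y)
    (hU'o : IsOpen U') (hU'1 : (1 : G) ∈ U') (hU'b : IsCompact (closure U'))
    (haar : Measure G) [haar.IsHaarMeasure] {M : Measure (G × Y)}
    (hM : ∀ T, MeasurableSet T → InjOn (actMap G Y) T → M T = μ (actMap G Y '' T)) :
    M = ((μ (U' • Y) / haar U') • haar).prod (crossMeasure μ U' Y) := by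
  have hprob := hY.isProbabilityMeasure hU'o hU'1
  have hh0 : haar U' ≠ 0 := (hU'o.measure_pos haar ⟨1, hU'1⟩).ne'
  have hht : haar U' ≠ ∞ := ((measure_mono subset_closure).trans_lt hU'b.measure_lt_top).ne
  have hc : μ (U' • Y) / haar U' ≠ ∞ := ENNReal.div_ne_top (measure_ne_top _ _) hh0
  have : SigmaFinite ((μ (U' • Y) / haar U') • haar) := by
    lift μ (U' • Y) / haar U' to NNReal using hc with c
    exact inferInstanceAs (SigmaFinite (c • haar))
  refine (Measure.prod_eq fun W B hW hB => ?_).symm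
  set m : Measure G := (M.restrict (univ ×ˢ B)).map Prod.fst with hm
  have hm_apply : ∀ W, MeasurableSet W → m W = M (W ×ˢ B) := by
    intro W hW
    rw [hm, Measure.map_apply measurable_fst hW, Measure.restrict_apply (measurable_fst hW)]
    congr 1
    ext p
    simp
  have hinv : m.IsMulLeftInvariant := by
    refine ⟨fun h => Measure.ext fun W hW => ?_⟩
    rw [Measure.map_apply (measurable_const_mul h) hW,
      hm_apply _ (measurable_const_mul h hW), hm_apply _ hW,
      ← hY.orbitMeasure_preimage_mul hU'o hU'1 hM h (hW.prod hB)]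
    congr 1
  have hmU : m U' = μ (U' • Y) * crossMeasure μ U' Y B := by
    rw [hm_apply _ hU'o.measurableSet, hM _ (hU'o.measurableSet.prod hB), image_actMap_prod,
      hY.crossMeasure_apply hU'o hB, ← mul_assoc,
      ENNReal.mul_inv_cancel (hY.measure_smul_ne_zero hU'o hU'1) (measure_ne_top _ _), one_mul]
    simpa using (hY.injOn_actMap 1).mono (Set.prod_mono (by simp) (subset_univ B))
  have hfin : IsFiniteMeasureOnCompacts m := by
    refine ⟨fun C hC => ?_⟩
    obtain ⟨t, ht⟩ := exists_finset_subset_biUnion_smul hC (hU'o.mem_nhds hU'1)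
    refine (measure_mono ht).trans_lt ((measure_biUnion_finset_le _ _).trans_lt ?_)
    refine ENNReal.sum_lt_top.2 fun g _ => ?_
    rw [measure_smul, hmU]
    exact ENNReal.mul_lt_top (measure_lt_top _ _) (measure_lt_top _ _)
  have hsc := Measure.isMulLeftInvariant_eq_smul m haar
  set c := Measure.haarScalarFactor m haar
  have hcU : (c : ℝ≥0∞) * haar U' = μ (U' • Y) * crossMeasure μ U' Y B := by
    rw [← hmU, hsc]
    rfl
  have hcW : M (W ×ˢ B) = (c : ℝ≥0∞) * haar W := by
    rw [← hm_apply W hW, hsc]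
    rfl
  have hc2 : (c : ℝ≥0∞) = μ (U' • Y) * crossMeasure μ U' Y B / haar U' := by
    rw [← hcU, ENNReal.mul_div_cancel_right hh0 hht]
  rw [hcW, hc2, Measure.smul_apply, smul_eq_mul, ENNReal.div_eq_inv_mul, ENNReal.div_eq_inv_mul]
  ring

/-- The partial bijections `y ↦ k y`, `k ∈ S`, of a cross section preserve its measure, as `G` is
unimodular: `U' B` is parametrized by `U' × B` as well as by the set of the `(w k, y)` with
`k y ∈ B`, whose slices are right translates of `U'`. -/
theorem IsCrossSection.crossMeasure_relPreimage [IsProbabilityMeasure μ]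
    (hY : IsCrossSection μ U' Y) (hU'o : IsOpen U') (hU'1 : (1 : G) ∈ U')
    (hU'b : IsCompact (closure U')) (haar : Measure G) [haar.IsHaarMeasure]
    [haar.IsMulRightInvariant] {S : Set G} (hSm : MeasurableSet S) (hS : IsSliceSet U' S)
    {B : Set Y} (hB : MeasurableSet B)
    (hBS : B ⊆ relPreimage (Function.swap (crossEdge (actPsi Y) S)) univ) :
    crossMeasure μ U' Y (relPreimage (crossEdge (actPsi Y) S) B) = crossMeasure μ U' Y B := by
  have := polishSpace_of_locallyCompact_group (G := G)
  have := hY.measurableSet.standardBorel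
  have hprob := hY.isProbabilityMeasure hU'o hU'1
  have hh0 : haar U' ≠ 0 := (hU'o.measure_pos haar ⟨1, hU'1⟩).ne'
  have hht : haar U' ≠ ∞ := ((measure_mono subset_closure).trans_lt hU'b.measure_lt_top).ne
  have hc : μ (U' • Y) / haar U' ≠ ∞ := ENNReal.div_ne_top (measure_ne_top _ _) hh0
  have hc0 : μ (U' • Y) / haar U' ≠ 0 :=
    (ENNReal.div_pos (hY.measure_smul_ne_zero hU'o hU'1) hht).ne'
  have : SigmaFinite ((μ (U' • Y) / haar U') • haar) := by
    lift μ (U' • Y) / haar U' to NNReal using hc with c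
    exact inferInstanceAs (SigmaFinite (c • haar))
  obtain ⟨M, hM⟩ := hY.exists_orbitMeasure hU'o hU'1
  have hprod := hY.orbitMeasure_eq_prod hU'o hU'1 hU'b haar hM
  have hpre := hY.measurableSet_relPreimage hU'o hU'1 hSm hB
  obtain ⟨g, hg⟩ := hS
  -- a point `k y` of `B` with `k ∈ S` determines `k` and `y`
  have huniq : ∀ {k k' : G} {y z : Y}, k ∈ S → k' ∈ S → k • (y : X) = k' • (z : X) →
      k = k' ∧ y = z := fun hk hk' h => by
    have := hY.eq_and_eq_of_translate (hg _ hk).2 (hg _ hk').2 (Subtype.coe_prop _)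
      (Subtype.coe_prop _) h
    exact ⟨this.1, Subtype.ext this.2⟩
  set Q : Set (G × G × Y) := {q | q.1 ∈ U' ∧ q.2.1 ∈ S ∧ q.2.1 • (q.2.2 : X) ∈ (Subtype.val '' B)}
  set f : G × G × Y → G × Y := fun q => (q.1 * q.2.1, q.2.2)
  have hBX : MeasurableSet (Subtype.val '' B : Set X) :=
    (MeasurableEmbedding.subtype_coe hY.measurableSet).measurableSet_image.2 hB
  have hQ : MeasurableSet Q := by
    refine (measurable_fst hU'o.measurableSet).inter
      (((measurable_fst.comp measurable_snd) hSm).inter ?_)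
    exact (measurable_actMap.comp measurable_snd) hBX
  have hf : Measurable f :=
    (measurable_fst.mul (measurable_fst.comp measurable_snd)).prodMk
      (measurable_snd.comp measurable_snd)
  have hactf : ∀ q, actMap G Y (f q) = q.1 • q.2.1 • (q.2.2 : X) := fun q => mul_smul _ _ _
  have hinjf : ∀ q ∈ Q, ∀ q' ∈ Q, actMap G Y (f q) = actMap G Y (f q') → q = q' := by
    rintro ⟨w, k, y⟩ ⟨hw, hk, b, hb, hby⟩ ⟨w', k', y'⟩ ⟨hw', hk', b', hb', hby'⟩ h
    rw [hactf, hactf] at h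
    simp only at hby hby' h hk hk' hw hw'
    rw [← hby, ← hby'] at h
    obtain ⟨h1, h2⟩ := hY.eq_and_eq hw hw' b.2 b'.2 h
    obtain ⟨h3, h4⟩ := huniq hk hk' (by rw [← hby, ← hby', h2])
    rw [h1, h3, h4]
  set T := f '' Q
  have hT : MeasurableSet T := hQ.image_of_measurable_injOn hf fun q hq q' hq' h =>
    hinjf q hq q' hq' (by rw [h])
  have hTinj : InjOn (actMap G Y) T := by
    rintro _ ⟨q, hq, rfl⟩ _ ⟨q', hq', rfl⟩ h
    rw [hinjf q hq q' hq' h]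
  have himg : actMap G Y '' T = actMap G Y '' (U' ×ˢ B) := by
    ext x
    constructor
    · rintro ⟨_, ⟨⟨w, k, y⟩, ⟨hw, hk, b, hb, hby⟩, rfl⟩, rfl⟩
      refine ⟨(w, b), ⟨hw, hb⟩, ?_⟩
      rw [hactf]
      exact congrArg (w • ·) hby
    · rintro ⟨⟨w, b⟩, ⟨hw, hb⟩, rfl⟩
      obtain ⟨y, -, hy⟩ := hBS hb
      obtain ⟨k, hk, hky⟩ := crossEdge_actPsi.1 hy
      refine ⟨_, ⟨(w, k, y), ⟨hw, hk, b, hb, hky.symm⟩, rfl⟩, ?_⟩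
      rw [hactf]
      exact congrArg (w • ·) hky
  have hMT : M T = M (U' ×ˢ B) := by
    rw [hM T hT hTinj, himg, hM _ (hU'o.measurableSet.prod hB)]
    simpa using (hY.injOn_actMap 1).mono (Set.prod_mono (by simp) (subset_univ B))
  rw [hprod, Measure.prod_prod, Measure.prod_apply_symm hT] at hMT
  have hslice : ∀ y, ((μ (U' • Y) / haar U') • haar) ((fun x => (x, y)) ⁻¹' T) =
      (relPreimage (crossEdge (actPsi Y) S) B).indicator
        (fun _ => ((μ (U' • Y) / haar U') • haar) U') y := by
    intro y
    by_cases hy : y ∈ relPreimage (crossEdge (actPsi Y) S) B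
    · rw [indicator_of_mem hy]
      obtain ⟨b, hb, hyb⟩ := hy
      obtain ⟨k, hk, hkb⟩ := crossEdge_actPsi.1 hyb
      have : (fun x => (x, y)) ⁻¹' T = (fun x => x * k⁻¹) ⁻¹' U' := by
        ext x
        constructor
        · rintro ⟨⟨w, k', y'⟩, ⟨hw, hk', b', hb', hby'⟩, h⟩
          obtain ⟨rfl, rfl⟩ := Prod.mk_inj.1 h
          have hkk : k' = k := by
            have h3 := (hg k' hk').1
            have h4 := (hg k hk).1
            -- `k' y = b'` and `k y = b` give `(g k'⁻¹) b' = (g k⁻¹) b`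
            have h5 : (g * k'⁻¹) • (b' : X) = (g * k⁻¹) • (b : X) := by
              rw [hby', ← hkb, mul_smul, mul_smul, inv_smul_smul, inv_smul_smul]
            have h6 := (hY.eq_and_eq h3 h4 b'.2 b.2 h5).1
            exact inv_injective (mul_left_cancel h6)
          subst hkk
          simpa using hw
        · intro hx
          exact ⟨(x * k⁻¹, k, y), ⟨hx, hk, b, hb, hkb.symm⟩, by simp [f]⟩
      rw [this, Measure.smul_apply, Measure.smul_apply, measure_preimage_mul_right]
    · rw [indicator_of_notMem hy]
      have : (fun x => (x, y)) ⁻¹' T = ∅ := by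
        refine eq_empty_of_forall_notMem ?_
        rintro x ⟨⟨w, k', y'⟩, ⟨hw, hk', b', hb', hby'⟩, h⟩
        obtain ⟨rfl, rfl⟩ := Prod.mk_inj.1 h
        exact hy ⟨b', hb', crossEdge_actPsi.2 ⟨k', hk', hby'.symm⟩⟩
      rw [this, measure_empty]
  simp_rw [hslice] at hMT
  rw [lintegral_indicator_const hpre] at hMT
  refine (ENNReal.mul_right_inj ?_ ?_).1 hMT
  · exact mul_ne_zero hc0 hh0
  · exact ENNReal.mul_ne_top hc hht

/-- The partial automorphism of a cross section with graph `Θ^S`. -/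
theorem IsCrossSection.exists_partialAut [IsProbabilityMeasure μ]
    (hY : IsCrossSection μ U' Y) (hU'o : IsOpen U') (hU'1 : (1 : G) ∈ U')
    (hU'b : IsCompact (closure U')) (haar : Measure G) [haar.IsHaarMeasure]
    [haar.IsMulRightInvariant] {S : Set G} (hSm : MeasurableSet S) (hS : IsSliceSet U' S) :
    ∃ φ : PartialAut (crossMeasure μ U' Y),
      ∀ y y', φ.graph y y' ↔ crossEdge (actPsi Y) S y y' := by
  refine exists_partialAut_of_biUnique (hY.biUnique_crossEdge hS)
    (fun B hB => hY.measurableSet_relPreimage hU'o hU'1 hSm hB) (fun B hB => ?_)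
    fun B hBS hB => hY.crossMeasure_relPreimage hU'o hU'1 hU'b haar hSm hS hB hBS
  rw [swap_crossEdge]
  exact hY.measurableSet_relPreimage hU'o hU'1 hSm.inv hB

theorem IsCrossSection.crossMeasure_relPreimage_le [IsProbabilityMeasure μ]
    (hY : IsCrossSection μ U' Y) (hU'o : IsOpen U') (hU'1 : (1 : G) ∈ U')
    (hU'b : IsCompact (closure U')) (haar : Measure G) [haar.IsHaarMeasure]
    [haar.IsMulRightInvariant] {S : Set G} (hSm : MeasurableSet S) (hS : IsSliceSet U' S)
    {B : Set Y} (hB : MeasurableSet B) :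
    crossMeasure μ U' Y (relPreimage (crossEdge (actPsi Y) S) B) ≤ crossMeasure μ U' Y B := by
  have hran : MeasurableSet (relPreimage (Function.swap (crossEdge (actPsi Y) S)) univ) := by
    rw [swap_crossEdge]
    exact hY.measurableSet_relPreimage hU'o hU'1 hSm.inv MeasurableSet.univ
  have heq : relPreimage (crossEdge (actPsi Y) S) B = relPreimage (crossEdge (actPsi Y) S)
      (B ∩ relPreimage (Function.swap (crossEdge (actPsi Y) S)) univ) := by
    refine Subset.antisymm ?_ (relPreimage_mono inter_subset_left)
    rintro y ⟨y', hy', h⟩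
    exact ⟨y', ⟨hy', y, trivial, h⟩, h⟩
  rw [heq, hY.crossMeasure_relPreimage hU'o hU'1 hU'b haar hSm hS (hB.inter hran)
    inter_subset_right]
  exact measure_mono inter_subset_left

end OrbitMeasure

/-! ### Edges in the regular ultraproduct -/

theorem sdiff_interior_inv {G : Type*} [Group G] [TopologicalSpace G] [IsTopologicalGroup G]
    (S : Set G) : (S \ interior S)⁻¹ = S⁻¹ \ interior S⁻¹ := by
  have h : (interior S)⁻¹ = interior S⁻¹ := (Homeomorph.inv G).preimage_interior S
  rw [← h]
  rfl

section UltraEdge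

variable {G : Type*} [Group G] [TopologicalSpace G] [IsTopologicalGroup G]
  {𝔲 : Ultrafilter ℕ} {X : ℕ → Type*} [∀ n, MeasurableSpace (X n)] [∀ n, MulAction G (X n)]
  {Y : ∀ n, Set (X n)} {ν : ∀ n, Measure (Y n)}

omit [∀ n, MeasurableSpace (X n)] in
theorem smul_mk_eq_mk_iff {g k : G} {x z : ∀ n, X n} :
    g • RegularUltraproduct.mk G 𝔲 X x = k • RegularUltraproduct.mk G 𝔲 X z ↔
      ∃ h : ℕ → G, Tendsto h 𝔲 (𝓝 (k⁻¹ * g)) ∧ ∀ᶠ n in (𝔲 : Filter ℕ), h n • x n = z n := by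
  have h0 : g • RegularUltraproduct.mk G 𝔲 X x = k • RegularUltraproduct.mk G 𝔲 X z ↔
      ∃ h : ℕ → G, Tendsto h 𝔲 (𝓝 1) ∧ ∀ᶠ n in (𝔲 : Filter ℕ), h n • g • x n = k • z n :=
    Quotient.eq (r := regularSetoid G 𝔲 X)
  rw [h0]
  constructor
  · rintro ⟨h, hh, hx⟩
    refine ⟨fun n => k⁻¹ * h n * g, ?_, hx.mono fun n hn => ?_⟩
    · simpa using (hh.const_mul k⁻¹).mul_const g
    · rw [mul_smul, mul_smul, hn, inv_smul_smul]
  · rintro ⟨h, hh, hx⟩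
    refine ⟨fun n => k * h n * g⁻¹, ?_, hx.mono fun n hn => ?_⟩
    · simpa [mul_assoc] using (hh.const_mul k).mul_const g⁻¹
    · rw [mul_smul, inv_smul_smul, mul_smul, hn]

theorem ultraPsi_mk (g : G) (y : ∀ n, Y n) :
    ultraPsi G 𝔲 ν g (LoebSpace.mk 𝔲 ν y) =
      g • RegularUltraproduct.mk G 𝔲 X fun n => (y n : X n) := rfl

theorem smul_ultraPsi_eq_iff {g : G} {y z : ∀ n, Y n} :
    g • ultraPsi G 𝔲 ν 1 (LoebSpace.mk 𝔲 ν y) = ultraPsi G 𝔲 ν 1 (LoebSpace.mk 𝔲 ν z) ↔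
      ∃ h : ℕ → G, Tendsto h 𝔲 (𝓝 g) ∧ ∀ᶠ n in (𝔲 : Filter ℕ), h n • (y n : X n) = z n := by
  rw [ultraPsi_mk, ultraPsi_mk, one_smul, smul_mk_eq_mk_iff]
  simp

omit [Group G] [IsTopologicalGroup G] in
theorem exists_mem_tendsto_of_isCompact {K : Set G} (hK : IsCompact K) {h : ℕ → G}
    (hh : ∀ᶠ n in (𝔲 : Filter ℕ), h n ∈ K) : ∃ k ∈ K, Tendsto h 𝔲 (𝓝 k) :=
  hK.ultrafilter_le_nhds (𝔲.map h) (le_principal_iff.2 hh)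

/-- A limit of couples in `Θ_n^S` is in `Θ_𝔲^S` if `S` is compact. -/
theorem crossEdge_of_ultraRel {S : Set G} (hS : IsCompact S) {y z : LoebSpace 𝔲 ν}
    (h : ultraRel 𝔲 ν (fun n => crossEdge (actPsi (Y n)) S) y z) :
    crossEdge (ultraPsi G 𝔲 ν) S y z := by
  obtain ⟨a, b, rfl, rfl, h⟩ := h
  have h' : ∀ n, ∃ k : G, crossEdge (actPsi (Y n)) S (a n) (b n) →
      k ∈ S ∧ k • (a n : X n) = b n := by
    intro n
    by_cases hn : crossEdge (actPsi (Y n)) S (a n) (b n)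
    · obtain ⟨k, hk⟩ := crossEdge_actPsi.1 hn
      exact ⟨k, fun _ => hk⟩
    · exact ⟨1, fun h => absurd h hn⟩
  choose k hk using h'
  obtain ⟨g, hg, hlim⟩ := exists_mem_tendsto_of_isCompact hS (h.mono fun n hn => (hk n hn).1)
  exact ⟨g, hg, smul_ultraPsi_eq_iff.2 ⟨k, hlim, h.mono fun n hn => (hk n hn).2⟩⟩

omit [TopologicalSpace G] [IsTopologicalGroup G] in
theorem ultraRel_of_tendsto {S : Set G} {a b : ∀ n, Y n} {k : ℕ → G}
    (hk : ∀ᶠ n in (𝔲 : Filter ℕ), k n ∈ S)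
    (h : ∀ᶠ n in (𝔲 : Filter ℕ), k n • (a n : X n) = b n) :
    ultraRel 𝔲 ν (fun n => crossEdge (actPsi (Y n)) S) (LoebSpace.mk 𝔲 ν a)
      (LoebSpace.mk 𝔲 ν b) :=
  ultraRel_mk_mk.2 ((hk.and h).mono fun n hn => crossEdge_actPsi.2 ⟨k n, hn.1, hn.2⟩)

/-- A couple in `Θ_𝔲^S` is a limit of couples in `Θ_n^S`, unless it is in `Θ_𝔲^{S \ int S}`. -/
theorem crossEdge_diff_interior_or_ultraRel {S : Set G} {y z : LoebSpace 𝔲 ν}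
    (h : crossEdge (ultraPsi G 𝔲 ν) S y z) :
    crossEdge (ultraPsi G 𝔲 ν) (S \ interior S) y z ∨
      ultraRel 𝔲 ν (fun n => crossEdge (actPsi (Y n)) S) y z := by
  obtain ⟨g, hg, h⟩ := h
  by_cases hgi : g ∈ interior S
  · right
    obtain ⟨a, rfl⟩ := LoebSpace.mk_surjective y
    obtain ⟨b, rfl⟩ := LoebSpace.mk_surjective z
    obtain ⟨k, hk, hkab⟩ := smul_ultraPsi_eq_iff.1 h
    exact ultraRel_of_tendsto (hk (mem_interior_iff_mem_nhds.1 hgi)) hkab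
  · exact Or.inl ⟨g, ⟨hg, hgi⟩, h⟩

/-- As `U'` is open, the uniqueness in the definition of a cross section passes to the limit. -/
theorem leftUnique_crossEdge_ultraPsi {μ : ∀ n, Measure (X n)} {U' : Set G}
    (hY : ∀ n, IsCrossSection (μ n) U' (Y n)) (hU'o : IsOpen U') {S : Set G}
    (hS : IsSliceSet U' S) : Relator.LeftUnique (crossEdge (ultraPsi G 𝔲 ν) S) := by
  obtain ⟨g, hg⟩ := hS
  rintro y z w ⟨k, hk, h⟩ ⟨k', hk', h'⟩
  obtain ⟨a, rfl⟩ := LoebSpace.mk_surjective y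
  obtain ⟨b, rfl⟩ := LoebSpace.mk_surjective z
  obtain ⟨c, rfl⟩ := LoebSpace.mk_surjective w
  obtain ⟨q, hq, hqa⟩ := smul_ultraPsi_eq_iff.1 h
  obtain ⟨q', hq', hqb⟩ := smul_ultraPsi_eq_iff.1 h'
  refine LoebSpace.mk_eq_mk.2 ?_
  filter_upwards [(hq.const_mul g⁻¹).eventually_mem (hU'o.mem_nhds (hg k hk).2),
    (hq'.const_mul g⁻¹).eventually_mem (hU'o.mem_nhds (hg k' hk').2), hqa, hqb]
    with n h1 h2 h3 h4
  exact Subtype.ext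
    ((hY n).eq_and_eq_of_translate h1 h2 (a n).2 (b n).2 (h3.trans h4.symm)).2

theorem biUnique_crossEdge_ultraPsi {μ : ∀ n, Measure (X n)} {U' : Set G}
    (hY : ∀ n, IsCrossSection (μ n) U' (Y n)) (hU'o : IsOpen U') {S : Set G}
    (hS : IsSliceSet U' S) : Relator.BiUnique (crossEdge (ultraPsi G 𝔲 ν) S) := by
  refine ⟨leftUnique_crossEdge_ultraPsi hY hU'o hS, fun y y' z h1 h2 => ?_⟩
  have h := leftUnique_crossEdge_ultraPsi (𝔲 := 𝔲) (ν := ν) hY hU'o hS.inv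
  rw [← swap_crossEdge] at h
  exact h h1 h2

/-- An internal cover of `S` pulls back to one of the preimage of `S`. -/
theorem loebOuter_relPreimage_ultraRel_le (h𝔲 : (𝔲 : Filter ℕ) ≤ cofinite)
    {Y : ℕ → Type*} [∀ n, MeasurableSpace (Y n)] {ν : ∀ n, Measure (Y n)}
    {r : ∀ n, Y n → Y n → Prop}
    (hm : ∀ n B, MeasurableSet B → MeasurableSet (relPreimage (r n) B))
    (hν : ∀ n B, MeasurableSet B → ν n (relPreimage (r n) B) ≤ ν n B)
    (S : Set (LoebSpace 𝔲 ν)) :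
    loebOuter 𝔲 ν (relPreimage (ultraRel 𝔲 ν r) S) ≤ loebOuter 𝔲 ν S := by
  rw [loebOuter_apply h𝔲, loebOuter_apply h𝔲]
  refine le_iInf fun A => le_iInf fun hA => le_iInf fun hS => ?_
  refine iInf_le_of_le (fun n => relPreimage (r n) (A n))
    (iInf_le_of_le (fun n => hm n _ (hA n)) (iInf_le_of_le ?_ ?_))
  · rintro _ ⟨z, hz, a, b, rfl, rfl, h⟩
    refine mk_mem_internalSet.2 ?_
    filter_upwards [h, mk_mem_internalSet.1 (hS hz)] with n h1 h2
    exact ⟨b n, h2, h1⟩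
  · exact le_of_tendsto_of_tendsto' (tendsto_limUnder_ultrafilter 𝔲 _)
      (tendsto_limUnder_ultrafilter 𝔲 _) fun n => hν n _ (hA n)

theorem relPreimage_ultraRel_univ
    {Y : ℕ → Type*} [∀ n, MeasurableSpace (Y n)] {ν : ∀ n, Measure (Y n)}
    (r : ∀ n, Y n → Y n → Prop) :
    relPreimage (ultraRel 𝔲 ν r) univ = internalSet 𝔲 ν fun n => relPreimage (r n) univ := by
  ext y
  obtain ⟨a, rfl⟩ := LoebSpace.mk_surjective y
  rw [mk_mem_internalSet]
  constructor
  · rintro ⟨z, -, h⟩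
    obtain ⟨b, rfl⟩ := LoebSpace.mk_surjective z
    exact (ultraRel_mk_mk.1 h).mono fun n hn => ⟨b n, trivial, hn⟩
  · intro h
    have h' : ∀ n, ∃ b : Y n, a n ∈ relPreimage (r n) univ → r n (a n) b := by
      intro n
      by_cases hn : a n ∈ relPreimage (r n) univ
      · obtain ⟨b, -, hb⟩ := hn
        exact ⟨b, fun _ => hb⟩
      · exact ⟨a n, fun h => absurd h hn⟩
    choose b hb using h'
    exact ⟨LoebSpace.mk 𝔲 ν b, trivial, ultraRel_mk_mk.2 (h.mono fun n hn => hb n hn)⟩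

end UltraEdge

theorem isCaratheodory_of_null {Y : Type*} {m : OuterMeasure Y} {N : Set Y} (hN : m N = 0) :
    m.IsCaratheodory N := by
  refine (OuterMeasure.isCaratheodory_iff_le' _).2 fun T => ?_
  calc m (T ∩ N) + m (T \ N) ≤ m N + m T := add_le_add (m.mono inter_subset_right)
        (m.mono sdiff_subset)
    _ = m T := by rw [hN, zero_add]

theorem loebMeasure_eq_zero {Y : ℕ → Type*} [∀ n, MeasurableSpace (Y n)] {𝔲 : Ultrafilter ℕ}
    {ν : ∀ n, Measure (Y n)} {N : Set (LoebSpace 𝔲 ν)} (hN : loebOuter 𝔲 ν N = 0) :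
    loebMeasure 𝔲 ν N = 0 := by
  have h : MeasurableSet N := isCaratheodory_of_null hN
  rw [loebMeasure, toMeasure_apply _ _ h, hN]

/-! ### Partial automorphisms of the ultraproduct -/

section UltraAut

variable {G : Type*} [Group G] [TopologicalSpace G] [IsTopologicalGroup G] [T2Space G]
  [LocallyCompactSpace G] [SecondCountableTopology G] [MeasurableSpace G] [BorelSpace G]
  {𝔲 : Ultrafilter ℕ} {X : ℕ → Type*} [∀ n, MeasurableSpace (X n)]
  [∀ n, StandardBorelSpace (X n)] {μ : ∀ n, Measure (X n)} [∀ n, IsProbabilityMeasure (μ n)]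
  [∀ n, MulAction G (X n)] [∀ n, MeasurableSMul₂ G (X n)]
  [∀ n, SMulInvariantMeasure G (X n) (μ n)] {U' : Set G} {Y : ∀ n, Set (X n)}

/-- One half of the measure preservation for `Θ_𝔲^S`. -/
theorem loebOuter_relPreimage_crossEdge_le (h𝔲 : (𝔲 : Filter ℕ) ≤ cofinite)
    (hY : ∀ n, IsCrossSection (μ n) U' (Y n)) (hU'o : IsOpen U') (hU'1 : (1 : G) ∈ U')
    (hU'b : IsCompact (closure U')) (haar : Measure G) [haar.IsHaarMeasure]
    [haar.IsMulRightInvariant] {S : Set G} (hSm : MeasurableSet S) (hS : IsSliceSet U' S)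
    {ν : ∀ n, Measure (Y n)} (hν : ∀ n, ν n = crossMeasure (μ n) U' (Y n))
    (hfr : loebOuter 𝔲 ν (relPreimage (crossEdge (ultraPsi G 𝔲 ν) (S \ interior S)) univ) = 0)
    (A : Set (LoebSpace 𝔲 ν)) :
    loebOuter 𝔲 ν (relPreimage (crossEdge (ultraPsi G 𝔲 ν) S) A) ≤ loebOuter 𝔲 ν A := by
  obtain rfl : ν = fun n => crossMeasure (μ n) U' (Y n) := funext hν
  calc _ ≤ loebOuter 𝔲 _ (relPreimage (crossEdge (ultraPsi G 𝔲 _) (S \ interior S)) univ ∪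
        relPreimage (ultraRel 𝔲 _ (fun n => crossEdge (actPsi (Y n)) S)) A) := by
        refine (loebOuter 𝔲 _).mono ?_
        rintro y ⟨z, hz, h⟩
        rcases crossEdge_diff_interior_or_ultraRel h with h | h
        · exact Or.inl ⟨z, trivial, h⟩
        · exact Or.inr ⟨z, hz, h⟩
    _ ≤ _ := measure_union_le _ _
    _ ≤ _ := by
        rw [hfr, zero_add]
        exact loebOuter_relPreimage_ultraRel_le h𝔲
          (fun n B hB => (hY n).measurableSet_relPreimage hU'o hU'1 hSm hB)
          (fun n B hB => (hY n).crossMeasure_relPreimage_le hU'o hU'1 hU'b haar hSm hS hB) A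

omit [∀ n, IsProbabilityMeasure (μ n)] [∀ n, SMulInvariantMeasure G (X n) (μ n)] in
theorem measurableSet_relPreimage_crossEdge_univ (h𝔲 : (𝔲 : Filter ℕ) ≤ cofinite)
    (hY : ∀ n, IsCrossSection (μ n) U' (Y n)) (hU'o : IsOpen U') (hU'1 : (1 : G) ∈ U')
    {S : Set G} (hSc : IsCompact S) {ν : ∀ n, Measure (Y n)}
    (hfr : loebOuter 𝔲 ν (relPreimage (crossEdge (ultraPsi G 𝔲 ν) (S \ interior S)) univ) = 0) :
    MeasurableSet (relPreimage (crossEdge (ultraPsi G 𝔲 ν) S) univ) := by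
  have h : relPreimage (crossEdge (ultraPsi G 𝔲 ν) S) univ =
      internalSet 𝔲 ν (fun n => relPreimage (crossEdge (actPsi (Y n)) S) univ) ∪
        relPreimage (crossEdge (ultraPsi G 𝔲 ν) (S \ interior S)) univ := by
    rw [← relPreimage_ultraRel_univ]
    refine Subset.antisymm ?_ (union_subset ?_ ?_)
    · rintro y ⟨z, hz, h⟩
      rcases crossEdge_diff_interior_or_ultraRel h with h | h
      · exact Or.inr ⟨z, trivial, h⟩
      · exact Or.inl ⟨z, hz, h⟩
    · rintro y ⟨z, hz, h⟩
      exact ⟨z, hz, crossEdge_of_ultraRel hSc h⟩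
    · rintro y ⟨z, hz, k, hk, h⟩
      exact ⟨z, hz, k, hk.1, h⟩
  rw [h]
  refine MeasurableSet.union (measurableSet_internalSet h𝔲 fun n => ?_)
    (isCaratheodory_of_null hfr)
  exact (hY n).measurableSet_relPreimage hU'o hU'1 hSc.measurableSet MeasurableSet.univ

/-- The partial automorphism of `Y_𝔲` with graph `Θ_𝔲^S`. -/
theorem exists_partialAut_ultraPsi (h𝔲 : (𝔲 : Filter ℕ) ≤ cofinite)
    (hY : ∀ n, IsCrossSection (μ n) U' (Y n)) (hU'o : IsOpen U') (hU'1 : (1 : G) ∈ U')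
    (hU'b : IsCompact (closure U')) (haar : Measure G) [haar.IsHaarMeasure]
    [haar.IsMulRightInvariant] {S : Set G} (hSc : IsCompact S) (hS : IsSliceSet U' S)
    {ν : ∀ n, Measure (Y n)} (hν : ∀ n, ν n = crossMeasure (μ n) U' (Y n))
    (hfr : loebOuter 𝔲 ν (relPreimage (crossEdge (ultraPsi G 𝔲 ν) (S \ interior S)) univ) = 0)
    (hfr' : loebOuter 𝔲 ν
      (relPreimage (crossEdge (ultraPsi G 𝔲 ν) (S \ interior S)⁻¹) univ) = 0) :
    ∃ φ : PartialAut (loebMeasure 𝔲 ν),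
      ∀ y z, φ.graph y z ↔ crossEdge (ultraPsi G 𝔲 ν) S y z := by
  rw [sdiff_interior_inv] at hfr'
  refine exists_partialAut_of_outerMeasure (biUnique_crossEdge_ultraPsi hY hU'o hS)
    (loebOuter_relPreimage_crossEdge_le h𝔲 hY hU'o hU'1 hU'b haar hSc.measurableSet hS hν hfr)
    ?_ (measurableSet_relPreimage_crossEdge_univ h𝔲 hY hU'o hU'1 hSc hfr) ?_
  · rw [swap_crossEdge]
    exact loebOuter_relPreimage_crossEdge_le h𝔲 hY hU'o hU'1 hU'b haar hSc.measurableSet.inv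
      hS.inv hν hfr'
  · rw [swap_crossEdge]
    exact measurableSet_relPreimage_crossEdge_univ h𝔲 hY hU'o hU'1 hSc.inv hfr'

end UltraAut

/-! ### Generic level sets -/

section Generic

variable {G : Type*} [Group G] [TopologicalSpace G] [IsTopologicalGroup G]

/-- The orbit of a point meets a cross section in a uniformly discrete set of group elements, with
a bound on the number of those in a compact set that depends on `U'` only. -/
theorem exists_forall_card_le {C U' : Set G} (hC : IsCompact C) (hU' : U' ∈ 𝓝 (1 : G)) :
    ∃ N : ℕ, ∀ {X : Type*} [MeasurableSpace X] [MulAction G X] {μ : Measure X} {Y : Set X},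
      IsCrossSection μ U' Y → ∀ (x : X) (t : Finset G), (∀ h ∈ t, h ∈ C ∧ h • x ∈ Y) →
      t.card ≤ N := by
  classical
  obtain ⟨V, hV, hVU⟩ := exists_nhds_split_inv hU'
  obtain ⟨T, hT⟩ := exists_finset_subset_biUnion_smul hC.inv (inv_mem_nhds_one G hV)
  refine ⟨T.card, fun {X} _ _ μ Y hY x t ht => ?_⟩
  have hch : ∀ h : G, ∃ g : G, h ∈ t → g ∈ T ∧ h⁻¹ ∈ g • V⁻¹ := by
    intro h
    by_cases hh : h ∈ t
    · obtain ⟨g, hg, hgV⟩ := mem_iUnion₂.1 (hT (inv_mem_inv.2 (ht h hh).1))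
      exact ⟨g, fun _ => ⟨hg, hgV⟩⟩
    · exact ⟨1, fun h => absurd h hh⟩
  choose f hf using hch
  refine Finset.card_le_card_of_injOn f (fun h hh => (hf h hh).1) fun h hh k hk hfhk => ?_
  have h1 := (hf h hh).2
  have h2 := (hf k hk).2
  rw [← hfhk] at h2
  obtain ⟨v, hv, hvh⟩ := h1
  obtain ⟨w, hw, hwk⟩ := h2
  simp only [smul_eq_mul] at hvh hwk
  have hU : k * h⁻¹ ∈ U' := by
    have := hVU w⁻¹ hw v⁻¹ hv
    have e : w⁻¹ / v⁻¹ = k * h⁻¹ := by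
      rw [← hvh, ← inv_inv k, ← hwk]
      simp [mul_assoc]
    rwa [e] at this
  have := (hY.eq_and_eq hU (mem_of_mem_nhds hU') (ht h hh).2 (ht k hk).2
    (by rw [mul_smul, inv_smul_smul, one_smul])).1
  exact (mul_inv_eq_one.1 this).symm

variable [T2Space G]
  [LocallyCompactSpace G] [SecondCountableTopology G] [MeasurableSpace G] [BorelSpace G]

/-- For disjoint sets of levels in `[a, ∞)`, the domains of the corresponding edge sets cover no
point of the cross section more than `N` times. -/
theorem exists_forall_sum_crossMeasure_le {U' : Set G} (hU'o : IsOpen U') (hU'1 : (1 : G) ∈ U')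
    {F : G → ℝ} (hF : Continuous F) (hFc : HasCompactSupport F) {a : ℝ} (ha : 0 < a) :
    ∃ N : ℕ, ∀ {X : Type*} [MeasurableSpace X] [StandardBorelSpace X] [MulAction G X]
      [MeasurableSMul₂ G X] {μ : Measure X} [IsProbabilityMeasure μ] [SMulInvariantMeasure G X μ]
      {Y : Set X}, IsCrossSection μ U' Y → ∀ {ι : Type} (s : Finset ι) (I : ι → Set ℝ),
      (∀ i ∈ s, MeasurableSet (I i) ∧ I i ⊆ Ici a) → (s : Set ι).PairwiseDisjoint I →
      ∑ i ∈ s, crossMeasure μ U' Y (relPreimage (crossEdge (actPsi Y) (F ⁻¹' I i)) univ) ≤ N := by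
  classical
  have hC : IsCompact (F ⁻¹' Ici a) := by
    refine IsCompact.of_isClosed_subset hFc (isClosed_Ici.preimage hF) fun x hx => ?_
    exact subset_tsupport F (ne_of_gt (ha.trans_le hx))
  obtain ⟨N, hN⟩ := exists_forall_card_le hC (hU'o.mem_nhds hU'1)
  refine ⟨N, fun {X} _ _ _ _ μ _ _ Y hY {ι} s I hI hd => ?_⟩
  have hprob := hY.isProbabilityMeasure hU'o hU'1
  set E : ι → Set Y := fun i => relPreimage (crossEdge (actPsi Y) (F ⁻¹' I i)) univ with hE
  have hEm : ∀ i ∈ s, MeasurableSet (E i) := fun i hi =>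
    hY.measurableSet_relPreimage hU'o hU'1 (hF.measurable (hI i hi).1) MeasurableSet.univ
  have hpt : ∀ y, ∑ i ∈ s, (E i).indicator (fun _ => (1 : ℝ≥0∞)) y ≤ N := by
    intro y
    have hch : ∀ i, ∃ h : G, y ∈ E i → F h ∈ I i ∧ h • (y : X) ∈ Y := by
      intro i
      by_cases hy : y ∈ E i
      · obtain ⟨z, -, hz⟩ := hy
        obtain ⟨h, hh, hz⟩ := crossEdge_actPsi.1 hz
        exact ⟨h, fun _ => ⟨hh, hz ▸ z.2⟩⟩
      · exact ⟨1, fun h => absurd h hy⟩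
    choose h hh using hch
    have hcard : (s.filter fun i => y ∈ E i).card ≤ N := by
      rw [← Finset.card_image_of_injOn (f := h)]
      · refine hN hY (y : X) _ fun k hk => ?_
        obtain ⟨i, hi, rfl⟩ := Finset.mem_image.1 hk
        obtain ⟨his, hiy⟩ := Finset.mem_filter.1 hi
        exact ⟨(hI i his).2 (hh i hiy).1, (hh i hiy).2⟩
      · intro i hi j hj hij
        obtain ⟨his, hiy⟩ := Finset.mem_filter.1 hi
        obtain ⟨hjs, hjy⟩ := Finset.mem_filter.1 hj
        have hj1 := (hh j hjy).1
        rw [← hij] at hj1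
        exact hd.elim_set his hjs (F (h i)) (hh i hiy).1 hj1
    calc ∑ i ∈ s, (E i).indicator (fun _ => (1 : ℝ≥0∞)) y
        = ((s.filter fun i => y ∈ E i).card : ℝ≥0∞) := by
          simp [indicator_apply]
      _ ≤ N := by exact_mod_cast hcard
  calc ∑ i ∈ s, crossMeasure μ U' Y (E i)
      = ∑ i ∈ s, ∫⁻ y, (E i).indicator (fun _ => 1) y ∂(crossMeasure μ U' Y) :=
        Finset.sum_congr rfl fun i hi => by rw [lintegral_indicator_const (hEm i hi), one_mul]
    _ = ∫⁻ y, ∑ i ∈ s, (E i).indicator (fun _ => 1) y ∂(crossMeasure μ U' Y) :=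
        (lintegral_finsetSum' _ fun i hi =>
          (measurable_const.indicator (hEm i hi)).aemeasurable).symm
    _ ≤ ∫⁻ _, N ∂(crossMeasure μ U' Y) := lintegral_mono hpt
    _ = N := by simp

variable {𝔲 : Ultrafilter ℕ} {X : ℕ → Type*} [∀ n, MeasurableSpace (X n)]
  [∀ n, StandardBorelSpace (X n)] {μ : ∀ n, Measure (X n)} [∀ n, IsProbabilityMeasure (μ n)]
  [∀ n, MulAction G (X n)] [∀ n, MeasurableSMul₂ G (X n)]
  [∀ n, SMulInvariantMeasure G (X n) (μ n)] {U' : Set G} {Y : ∀ n, Set (X n)}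

/-- All but countably many level sets of a compactly supported function contribute only null
sets to the cross equivalence relation, because disjoint level sets contribute disjoint parts of
an edge set of finite measure. -/
theorem countable_setOf_level_ne_zero (hU'o : IsOpen U') (hU'1 : (1 : G) ∈ U')
    (hY : ∀ n, IsCrossSection (μ n) U' (Y n))
    {ν : ∀ n, Measure (Y n)} (hν : ∀ n, ν n = crossMeasure (μ n) U' (Y n))
    {F : G → ℝ} (hF : Continuous F) (hFc : HasCompactSupport F) :
    {t : ℝ | 0 < t ∧
      loebOuter 𝔲 ν (relPreimage (crossEdge (ultraPsi G 𝔲 ν) (F ⁻¹' {t})) univ) ≠ 0}.Countable := by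
  classical
  obtain rfl : ν = fun n => crossMeasure (μ n) U' (Y n) := funext hν
  set ν : ∀ n, Measure (Y n) := fun n => crossMeasure (μ n) U' (Y n)
  set w : ℝ → ℝ≥0∞ := fun t =>
    loebOuter 𝔲 ν (relPreimage (crossEdge (ultraPsi G 𝔲 ν) (F ⁻¹' {t})) univ) with hw
  have hfin : ∀ m : ℕ, {t : ℝ | 1 / ((m : ℝ) + 1) < t ∧ ((m : ℝ≥0∞) + 1)⁻¹ ≤ w t}.Finite := by
    intro m
    obtain ⟨N, hN⟩ := exists_forall_sum_crossMeasure_le hU'o hU'1 hF hFc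
      (a := 1 / ((m : ℝ) + 1)) (by positivity)
    by_contra hinf
    -- more than `N (m + 1)` such levels have disjoint neighborhoods of total measure `> N`
    obtain ⟨s, hs, hcard⟩ := Set.Infinite.exists_subset_card_eq hinf (N * (m + 1) + 1)
    obtain ⟨I, hI, hId⟩ := s.finite_toSet.t2_separation
    set J : ℝ → Set ℝ := fun t => I t ∩ Ioi (1 / ((m : ℝ) + 1))
    have hJd : (s : Set ℝ).PairwiseDisjoint J := fun i hi j hj hij =>
      (hId hi hj hij).mono inter_subset_left inter_subset_left
    have hJo : ∀ t, IsOpen (J t) := fun t => (hI t).2.inter isOpen_Ioi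
    have hsum := fun n => hN (hY n) s J
      (fun t _ => ⟨(hJo t).measurableSet, inter_subset_right.trans Ioi_subset_Ici_self⟩) hJd
    have hlim := fun t => tendsto_limUnder_ultrafilter 𝔲
      (fun n => ν n (relPreimage (crossEdge (actPsi (Y n)) (F ⁻¹' J t)) univ))
    have hle : ∑ t ∈ s, limUnder (𝔲 : Filter ℕ)
        (fun n => ν n (relPreimage (crossEdge (actPsi (Y n)) (F ⁻¹' J t)) univ)) ≤ N :=
      le_of_tendsto' (tendsto_finsetSum s fun t _ => hlim t) hsum
    have hge : ∀ t ∈ s, ((m : ℝ≥0∞) + 1)⁻¹ ≤ limUnder (𝔲 : Filter ℕ)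
        (fun n => ν n (relPreimage (crossEdge (actPsi (Y n)) (F ⁻¹' J t)) univ)) := by
      intro t ht
      refine (hs ht).2.trans ((OuterMeasure.ofFunction_le _).trans ?_)
      refine iInf_le_of_le _ (iInf_le_of_le (fun n => ?_) (iInf_le_of_le ?_ le_rfl))
      · exact (hY n).measurableSet_relPreimage hU'o hU'1
          (hF.measurable (hJo t).measurableSet) MeasurableSet.univ
      · rintro y ⟨z, -, h, hh, hyz⟩
        obtain ⟨a, rfl⟩ := LoebSpace.mk_surjective y
        obtain ⟨b, rfl⟩ := LoebSpace.mk_surjective z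
        obtain ⟨k, hk, hkab⟩ := smul_ultraPsi_eq_iff.1 hyz
        have hhJ : h ∈ F ⁻¹' J t := by
          change F h = t at hh
          change F h ∈ J t
          rw [hh]
          exact ⟨(hI t).1, (hs ht).1⟩
        refine mk_mem_internalSet.2 ?_
        filter_upwards [hk.eventually_mem (((hJo t).preimage hF).mem_nhds hhJ), hkab] with n h1 h2
        exact ⟨b n, trivial, crossEdge_actPsi.2 ⟨k n, h1, h2⟩⟩
    have h1 : ((N * (m + 1) + 1 : ℕ) : ℝ≥0∞) * ((m : ℝ≥0∞) + 1)⁻¹ ≤ N := by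
      rw [← hcard, ← nsmul_eq_mul, ← Finset.sum_const]
      exact (Finset.sum_le_sum hge).trans hle
    rw [← div_eq_mul_inv, ENNReal.div_le_iff (by simp) (by finiteness)] at h1
    have h2 : N * (m + 1) + 1 ≤ N * (m + 1) := by exact_mod_cast h1
    omega
  refine (countable_iUnion fun m => (hfin m).countable).mono ?_
  rintro t ⟨ht, hwt⟩
  obtain ⟨m1, hm1⟩ := exists_nat_one_div_lt ht
  obtain ⟨m2, hm2⟩ := ENNReal.exists_inv_nat_lt hwt
  refine mem_iUnion.2 ⟨max m1 m2, ?_, ?_⟩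
  · refine lt_of_le_of_lt ?_ hm1
    have : (m1 : ℝ) ≤ (max m1 m2 : ℕ) := by exact_mod_cast le_max_left _ _
    gcongr
  · refine le_trans ?_ hm2.le
    have : (m2 : ℝ≥0∞) ≤ (max m1 m2 : ℕ) := by exact_mod_cast le_max_right _ _
    exact ENNReal.inv_le_inv.2 (this.trans le_self_add)

end Generic

/-! ### Compact generation -/

section Generation

variable {G : Type*} [Group G] [TopologicalSpace G] [IsTopologicalGroup G] [T2Space G]
  [LocallyCompactSpace G] [SecondCountableTopology G] [MeasurableSpace G] [BorelSpace G]

/-- The points `y` with `d y ∉ U⁻¹ K' Y` form a small set if `K' Y` has almost full measure: their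
translates by `d⁻¹ U d` are moved by `d` to the complement of `K' Y`. -/
theorem exists_forall_crossMeasure_compl_le {U' : Set G} (hU'o : IsOpen U')
    (hU'1 : (1 : G) ∈ U') (hU'b : IsCompact (closure U')) {U : Set G} (hU : IsCompact U)
    (hU1 : U ∈ 𝓝 (1 : G)) {K' : Set G} (hK' : IsCompact K') (d : G) :
    ∃ N N' : ℕ, ∀ {X : Type*} [MeasurableSpace X] [StandardBorelSpace X] [MulAction G X]
      [MeasurableSMul₂ G X] {μ : Measure X} [IsProbabilityMeasure μ] [SMulInvariantMeasure G X μ]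
      {Y : Set X}, IsCrossSection μ U' Y →
      crossMeasure μ U' Y (relPreimage (crossEdge (actPsi Y) (K'⁻¹ * U * {d})) univ)ᶜ ≤
        N' / μ (K' • Y) * (N * (1 - μ (K' • Y))) := by
  have hW : (fun x => d * x * d⁻¹) ⁻¹' U ∈ 𝓝 (1 : G) := by
    have h : Continuous fun x : G => d * x * d⁻¹ := by fun_prop
    exact h.continuousAt.preimage_mem_nhds (by simpa using hU1)
  obtain ⟨N, hN⟩ := exists_forall_measure_smul_le hU'b hW
  obtain ⟨N', hN'⟩ := exists_forall_measure_smul_le hK' (hU'o.mem_nhds hU'1)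
  -- the summand `1` excludes the junk value `0 / 0 = 0` on the right
  refine ⟨N, N' + 1, fun {X} _ _ _ _ μ _ _ Y hY => ?_⟩
  have hSm : MeasurableSet (K'⁻¹ * U * {d}) :=
    ((hK'.inv.mul hU).mul isCompact_singleton).measurableSet
  set A := relPreimage (crossEdge (actPsi Y) (K'⁻¹ * U * {d})) univ
  have hA : MeasurableSet A := hY.measurableSet_relPreimage hU'o hU'1 hSm MeasurableSet.univ
  have hKY : MeasurableSet (K' • Y) := by
    have := hY.measurableSet_smul hU'o hU'1 hK'.measurableSet (B := univ) MeasurableSet.univ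
    rwa [image_univ, Subtype.range_coe] at this
  set W := (fun x => d * x * d⁻¹) ⁻¹' U
  have hsub : d • (W • (Subtype.val '' Aᶜ : Set X)) ⊆ (K' • Y)ᶜ := by
    rintro _ ⟨_, ⟨w, hw, _, ⟨b, hb, rfl⟩, rfl⟩, rfl⟩ ⟨k, hk, y, hy, hky⟩
    refine hb ⟨⟨y, hy⟩, trivial, crossEdge_actPsi.2 ⟨k⁻¹ * (d * w * d⁻¹) * d, ?_, ?_⟩⟩
    · exact mul_mem_mul (mul_mem_mul (inv_mem_inv.2 hk) hw) rfl
    · have hky : k • y = d • w • (b : X) := hky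
      have e : y = k⁻¹ • d • w • (b : X) := by rw [← hky, inv_smul_smul]
      change _ = y
      rw [e]
      simp [mul_smul]
  have h1 : μ (U' • (Subtype.val '' Aᶜ : Set X)) ≤ N * (1 - μ (K' • Y)) := by
    calc μ (U' • (Subtype.val '' Aᶜ : Set X)) ≤ μ (closure U' • (Subtype.val '' Aᶜ : Set X)) :=
          measure_mono (smul_subset_smul_right subset_closure)
      _ ≤ N * μ (W • (Subtype.val '' Aᶜ : Set X)) := hN μ _
      _ = N * μ (d • (W • (Subtype.val '' Aᶜ : Set X))) := by rw [measure_smul]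
      _ ≤ N * μ (K' • Y)ᶜ := by gcongr
      _ = N * (1 - μ (K' • Y)) := by rw [prob_compl_eq_one_sub hKY]
  have h2 : (μ (U' • Y))⁻¹ ≤ (N' + 1 : ℕ) / μ (K' • Y) := by
    rw [ENNReal.le_div_iff_mul_le (Or.inr (by simp)) (Or.inr (by finiteness))]
    calc (μ (U' • Y))⁻¹ * μ (K' • Y) ≤ (μ (U' • Y))⁻¹ * (N' * μ (U' • Y)) := by
          gcongr
          exact hN' μ Y
      _ = N' := by
          rw [mul_left_comm, ENNReal.inv_mul_cancel (hY.measure_smul_ne_zero hU'o hU'1)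
            (measure_ne_top _ _), mul_one]
      _ ≤ (N' + 1 : ℕ) := by exact_mod_cast Nat.le_succ N'
  rw [hY.crossMeasure_apply hU'o hA.compl]
  exact mul_le_mul' h2 h1

variable {𝔲 : Ultrafilter ℕ} {X : ℕ → Type*} [∀ n, MeasurableSpace (X n)]
  [∀ n, StandardBorelSpace (X n)] {μ : ∀ n, Measure (X n)} [∀ n, IsProbabilityMeasure (μ n)]
  [∀ n, MulAction G (X n)] [∀ n, MeasurableSMul₂ G (X n)]
  [∀ n, SMulInvariantMeasure G (X n) (μ n)] {U' : Set G} {Y : ∀ n, Set (X n)}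

/-- If `μ_n(K' Y_n) → 1` then almost every orbit in the regular ultraproduct that meets `Y_𝔲` is
covered by the translates of `Y_𝔲` by a fixed compact set. -/
theorem exists_null_forall_smul_eq_smul (hU'o : IsOpen U') (hU'1 : (1 : G) ∈ U')
    (hU'b : IsCompact (closure U')) (hY : ∀ n, IsCrossSection (μ n) U' (Y n))
    {ν : ∀ n, Measure (Y n)} (hν : ∀ n, ν n = crossMeasure (μ n) U' (Y n))
    {U : Set G} (hU : IsCompact U) (hU1 : U ∈ 𝓝 (1 : G)) {K' : Set G} (hK' : IsCompact K')
    (hlim : Tendsto (fun n => μ n (K' • Y n)) (𝔲 : Filter ℕ) (𝓝 1)) :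
    ∃ N : Set (LoebSpace 𝔲 ν), loebOuter 𝔲 ν N = 0 ∧ ∀ y ∉ N, ∀ g : G,
      ∃ z, ∃ k ∈ U * U⁻¹ * K', g • ultraPsi G 𝔲 ν 1 y = k • ultraPsi G 𝔲 ν 1 z := by
  obtain rfl : ν = fun n => crossMeasure (μ n) U' (Y n) := funext hν
  set ν : ∀ n, Measure (Y n) := fun n => crossMeasure (μ n) U' (Y n)
  set d := TopologicalSpace.denseSeq G
  set A : ℕ → ∀ n, Set (Y n) := fun i n =>
    relPreimage (crossEdge (actPsi (Y n)) (K'⁻¹ * U * {d i})) univ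
  refine ⟨⋃ i, internalSet 𝔲 ν fun n => (A i n)ᶜ, ?_, fun y hy g => ?_⟩
  · refine measure_iUnion_null fun i => ?_
    obtain ⟨N, N', hN⟩ := exists_forall_crossMeasure_compl_le hU'o hU'1 hU'b hU hU1 hK' (d i)
    refine loebOuter_eq_zero (fun n => ?_) Subset.rfl ?_
    · exact ((hY n).measurableSet_relPreimage hU'o hU'1
        ((hK'.inv.mul hU).mul isCompact_singleton).measurableSet MeasurableSet.univ).compl
    · refine tendsto_of_tendsto_of_tendsto_of_le_of_le tendsto_const_nhds ?_
        (fun n => zero_le) (fun n => hN (hY n))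
      have h1 : Tendsto (fun n => (N' : ℝ≥0∞) / μ n (K' • Y n)) 𝔲 (𝓝 (N' / 1)) :=
        ENNReal.Tendsto.const_div hlim (Or.inr (ENNReal.natCast_ne_top _))
      have h2 : Tendsto (fun n => (N : ℝ≥0∞) * (1 - μ n (K' • Y n))) 𝔲 (𝓝 (N * (1 - 1))) :=
        ENNReal.Tendsto.const_mul
          (ENNReal.Tendsto.sub tendsto_const_nhds hlim (Or.inl ENNReal.one_ne_top))
          (Or.inr (ENNReal.natCast_ne_top _))
      have h3 := ENNReal.Tendsto.mul h1 (Or.inr (by finiteness)) h2 (Or.inr (by finiteness))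
      simpa using h3
  · obtain ⟨a, rfl⟩ := LoebSpace.mk_surjective y
    have hg : {x : G | g * x⁻¹ ∈ U} ∈ 𝓝 g := by
      have h : Continuous fun x : G => g * x⁻¹ := by fun_prop
      exact h.continuousAt.preimage_mem_nhds (by simpa using hU1)
    obtain ⟨_, ⟨i, rfl⟩, hi⟩ := (TopologicalSpace.denseRange_denseSeq G).inter_nhds_nonempty hg
    have hai : ∀ᶠ n in (𝔲 : Filter ℕ), a n ∈ A i n := by
      by_contra h
      rw [← Ultrafilter.eventually_not] at h
      exact hy (mem_iUnion.2 ⟨i, mk_mem_internalSet.2 h⟩)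
    have hch : ∀ n, ∃ p : G × Y n, a n ∈ A i n →
        p.1 ∈ U * U⁻¹ * K' ∧ g • (a n : X n) = p.1 • (p.2 : X n) := by
      intro n
      by_cases hn : a n ∈ A i n
      · obtain ⟨z, -, hz⟩ := hn
        obtain ⟨_, ⟨_, ⟨k, hk, u, hu, rfl⟩, _, rfl, rfl⟩, hz⟩ := crossEdge_actPsi.1 hz
        refine ⟨(g * (d i)⁻¹ * u⁻¹ * k⁻¹, z), fun _ => ⟨?_, ?_⟩⟩
        · exact mul_mem_mul (mul_mem_mul hi (inv_mem_inv.2 hu)) hk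
        · rw [← hz]
          simp [mul_smul]
      · exact ⟨(1, a n), fun h => absurd h hn⟩
    choose p hp using hch
    obtain ⟨q, hq, hlimq⟩ := exists_mem_tendsto_of_isCompact ((hU.mul hU.inv).mul hK')
      (hai.mono fun n hn => (hp n hn).1)
    refine ⟨LoebSpace.mk 𝔲 ν fun n => (p n).2, q, hq, ?_⟩
    rw [ultraPsi_mk, ultraPsi_mk, one_smul, one_smul, smul_mk_eq_mk_iff]
    refine ⟨fun n => (p n).1⁻¹ * g, hlimq.inv.mul_const g, hai.mono fun n hn => ?_⟩
    rw [mul_smul, (hp n hn).2, inv_smul_smul]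

/-- If all translates of `Ψ(1, y)` are in `K₁ Ψ(1, Y)`, then a word in the generators of `G` that
moves `Ψ(1, y)` to `Ψ(1, y')` can be followed by a path in `Y` with bounded steps. -/
theorem crossRelGen_of_forall_smul_eq_smul {G X Y : Type*} [Group G] [MulAction G X]
    {Ψ : G → Y → X} {C K₁ K : Set G} (hC : Subgroup.closure C = ⊤) (hK₁ : (1 : G) ∈ K₁)
    (hK : K₁⁻¹ * (C ∪ C⁻¹ ∪ {1}) * K₁ ⊆ K) {y : Y}
    (hy : ∀ g : G, ∃ z, ∃ k ∈ K₁, g • Ψ 1 y = k • Ψ 1 z) {y' : Y} (h : crossRel Ψ y y') :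
    crossRelGen Ψ K y y' := by
  have hedge : ∀ {z z' : Y} {k k' s : G}, k ∈ K₁ → k' ∈ K₁ → s ∈ C ∪ C⁻¹ ∪ {1} →
      s • k • Ψ 1 z = k' • Ψ 1 z' → Relation.EqvGen (crossEdge Ψ K) z z' := by
    intro z z' k k' s hk hk' hs hz
    refine Relation.EqvGen.rel _ _ ⟨k'⁻¹ * s * k,
      hK (mul_mem_mul (mul_mem_mul (inv_mem_inv.2 hk') hs) hk), ?_⟩
    rw [mul_smul, mul_smul, hz, inv_smul_smul]
  have hstep : ∀ s ∈ C ∪ C⁻¹ ∪ {1}, ∀ x : G,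
      (∀ z, ∀ k ∈ K₁, x • Ψ 1 y = k • Ψ 1 z → Relation.EqvGen (crossEdge Ψ K) y z) →
      ∀ z, ∀ k ∈ K₁, (s * x) • Ψ 1 y = k • Ψ 1 z → Relation.EqvGen (crossEdge Ψ K) y z := by
    intro s hs x ih z k hk hz
    obtain ⟨z', k', hk', hz'⟩ := hy x
    refine (ih z' k' hk' hz').trans _ _ _ (hedge hk' hk hs ?_)
    rw [← hz, mul_smul, hz']
  have key : ∀ g : G, ∀ z, ∀ k ∈ K₁, g • Ψ 1 y = k • Ψ 1 z →
      Relation.EqvGen (crossEdge Ψ K) y z := by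
    intro g
    have hg : g ∈ Subgroup.closure C := hC ▸ Subgroup.mem_top g
    induction hg using Subgroup.closure_induction_left with
    | one => exact fun z k hk hz => hedge hK₁ hk (Or.inr rfl) (by simpa using hz)
    | mul_left x hx y _ ih => exact hstep x (Or.inl (Or.inl hx)) y ih
    | inv_mul_cancel x hx y _ ih => exact hstep x⁻¹ (Or.inl (Or.inr (inv_mem_inv.2 hx))) y ih
  obtain ⟨g, hg⟩ := h
  exact key g y' 1 hK₁ (by rw [hg, one_smul])

end Generation

/-! ### Generic graphing codes -/

section Code

variable {G : Type*} [Group G] [TopologicalSpace G] [IsTopologicalGroup G]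

/-- A compact symmetric set `K ⊇ L` and a graphing code for it, in generic position with respect to
an outer measure `w` that vanishes on almost all level sets. Here `K` is the closure of `{f > t}`
for a bump function `f`, taken instead of `{f ≥ t}` so that interior points `g_j` of `K` are dense
in `K`, and `V_j⁻¹ g_j` is the part of `K` where `φ(g_j h⁻¹) ≥ s`, for a bump function `φ` at the
identity. -/
theorem exists_kGraphingCode [T2Space G] [LocallyCompactSpace G] [MeasurableSpace G]
    [BorelSpace G] (w : OuterMeasure G)
    (hw : ∀ F : G → ℝ, Continuous F → HasCompactSupport F →
      {t : ℝ | 0 < t ∧ w (F ⁻¹' {t}) ≠ 0}.Countable)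
    {U L : Set G} (hU : U ∈ 𝓝 (1 : G)) (hL : IsCompact L) :
    ∃ K : Set G, IsCompact K ∧ K⁻¹ = K ∧ L ⊆ K ∧ ∃ (m : ℕ) (c : KGraphingCode U K m),
      ∀ j, IsCompact ((c.V j)⁻¹ * {c.g j}) ∧
        w (((c.V j)⁻¹ * {c.g j}) \ interior ((c.V j)⁻¹ * {c.g j})) = 0 ∧
        w (((c.V j)⁻¹ * {c.g j}) \ interior ((c.V j)⁻¹ * {c.g j}))⁻¹ = 0 := by
  obtain ⟨f₀, hf₀L, -, hf₀c, hf₀⟩ := exists_continuous_one_zero_of_isCompact (hL.union hL.inv)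
    isClosed_empty (disjoint_empty _)
  set f : G → ℝ := fun h => f₀ h * f₀ h⁻¹ with hf
  have hfcont : Continuous f := by fun_prop
  have hfc : HasCompactSupport f := hf₀c.mul_right
  have hfinv : ∀ h, f h⁻¹ = f h := fun h => by simp [hf, mul_comm]
  have hfL : ∀ h ∈ L, f h = 1 := by
    intro h hh
    have h1 := hf₀L (Or.inl hh : h ∈ L ∪ L⁻¹)
    have h2 := hf₀L (Or.inr (inv_mem_inv.2 hh) : h⁻¹ ∈ L ∪ L⁻¹)
    simp only [hf, h1, h2, Pi.one_apply, mul_one]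
  obtain ⟨t, htw, ht0, ht1⟩ := ((hw f hfcont hfc).dense_compl ℝ).exists_between
    (zero_lt_one (α := ℝ))
  have hwt : w (f ⁻¹' {t}) = 0 := by
    by_contra h
    exact htw ⟨ht0, h⟩
  set O : Set G := {h | t < f h} with hO
  have hOo : IsOpen O := isOpen_lt continuous_const hfcont
  set K := closure O with hKdef
  have hKf : ∀ h ∈ K, t ≤ f h := fun h hh =>
    closure_minimal (fun x hx => le_of_lt hx) (isClosed_le continuous_const hfcont) hh
  have hK : IsCompact K := IsCompact.of_isClosed_subset hfc isClosed_closure fun h hh =>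
    subset_tsupport f (ne_of_gt (ht0.trans_le (hKf h hh)))
  have hKinv : K⁻¹ = K := by
    have h1 : O⁻¹ = O := by
      ext h
      simp [hO, hfinv]
    have h2 : (closure O)⁻¹ = closure O⁻¹ := (Homeomorph.inv G).preimage_closure O
    rw [hKdef, h2, h1]
  refine ⟨K, hK, hKinv, fun h hh => subset_closure ?_, ?_⟩
  · change t < f h
    rwa [hfL h hh]
  -- a neighborhood of the identity on which the conditions of a code hold uniformly in `g ∈ K`
  have htube : ∀ᶠ p : G × G in 𝓝 (1, 1), ∀ g ∈ K,
      g * p.1 * g⁻¹ * p.2 ∈ U ∧ g⁻¹ * p.1⁻¹ * g ∈ U ∧ p.1 ∈ U := by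
    refine hK.eventually_forall_of_forall_eventually fun g _ => ?_
    have c1 : Continuous fun z : (G × G) × G => z.2 * z.1.1 * z.2⁻¹ * z.1.2 := by fun_prop
    have c2 : Continuous fun z : (G × G) × G => z.2⁻¹ * z.1.1⁻¹ * z.2 := by fun_prop
    have c3 : Continuous fun z : (G × G) × G => z.1.1 := by fun_prop
    exact ((c1.continuousAt (x := ((1, 1), g))).eventually_mem (by simpa using hU)).and
      (((c2.continuousAt (x := ((1, 1), g))).eventually_mem (by simpa using hU)).and
        ((c3.continuousAt (x := ((1, 1), g))).eventually_mem (by simpa using hU)))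
  rw [nhds_prod_eq] at htube
  obtain ⟨W, hW, hWsub⟩ := mem_prod_self_iff.1 htube
  have hWU := fun v (hv : v ∈ W) v' (hv' : v' ∈ W) => hWsub (mk_mem_prod hv hv')
  obtain ⟨φ, hφ1, hφ0, hφc, hφ⟩ := exists_continuous_one_zero_of_isCompact
    (isCompact_singleton (x := (1 : G))) (isOpen_interior (s := W)).isClosed_compl
    (disjoint_singleton_left.2 (by simpa [mem_interior_iff_mem_nhds] using hW))
  have hφ1 : φ 1 = 1 := hφ1 rfl
  have hφW : ∀ v, 0 < φ v → v ∈ W := by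
    intro v hv
    by_contra hvW
    exact hv.ne' (hφ0 fun h => hvW (interior_subset h))
  -- finitely many `g ∈ O` such that the sets `{φ > 1 / 2}⁻¹ g` cover `K`
  have hcov : ∀ k : G, ∃ g : G, k ∈ K → g ∈ O ∧ 1 / 2 < φ (g * k⁻¹) := by
    intro k
    by_cases hk : k ∈ K
    · have h1 : {g : G | 1 / 2 < φ (g * k⁻¹)} ∈ 𝓝 k := by
        refine IsOpen.mem_nhds (isOpen_lt continuous_const (by fun_prop)) ?_
        simp only [mem_ofPred_eq, mul_inv_cancel, hφ1]
        norm_num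
      obtain ⟨g, hg, hgO⟩ := mem_closure_iff_nhds.1 hk _ h1
      exact ⟨g, fun _ => ⟨hgO, hg⟩⟩
    · exact ⟨1, fun h => absurd h hk⟩
  choose γ hγ using hcov
  obtain ⟨T, hTK, hT⟩ := hK.elim_nhds_subcover (fun k => {h | 1 / 2 < φ (γ k * h⁻¹)})
    fun k hk => IsOpen.mem_nhds (isOpen_lt continuous_const (by fun_prop)) (hγ k hk).2
  set e := T.equivFin
  set g : Fin T.card → G := fun j => γ (e.symm j) with hg
  have hgO : ∀ j, g j ∈ O := fun j => (hγ _ (hTK _ (e.symm j).2)).1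
  have hgcov : ∀ h ∈ K, ∃ j, 1 / 2 < φ (g j * h⁻¹) := by
    intro h hh
    obtain ⟨k, hk, hkh⟩ := mem_iUnion₂.1 (hT hh)
    exact ⟨e ⟨k, hk⟩, by simpa [hg] using hkh⟩
  -- a level of `φ` that is generic for all the `g j`; below `1 / 2`, so that the sets still cover `K`
  have hcount : (⋃ j, ({s : ℝ | 0 < s ∧ w ((fun h => φ (g j * h⁻¹)) ⁻¹' {s}) ≠ 0} ∪
      {s : ℝ | 0 < s ∧ w ((fun h => φ (g j * h)) ⁻¹' {s}) ≠ 0})).Countable := by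
    refine countable_iUnion fun j => (hw _ (by fun_prop) ?_).union (hw _ (by fun_prop) ?_)
    · exact hφc.comp_homeomorph ((Homeomorph.inv G).trans (Homeomorph.mulLeft (g j)))
    · exact hφc.comp_homeomorph (Homeomorph.mulLeft (g j))
  obtain ⟨s, hsw, hs0, hs1⟩ := (hcount.dense_compl ℝ).exists_between (one_half_pos (α := ℝ))
  have hws : ∀ j, w ((fun h => φ (g j * h⁻¹)) ⁻¹' {s}) = 0 ∧
      w ((fun h => φ (g j * h)) ⁻¹' {s}) = 0 := by
    intro j
    constructor
    · by_contra h
      exact hsw (mem_iUnion.2 ⟨j, Or.inl ⟨hs0, h⟩⟩)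
    · by_contra h
      exact hsw (mem_iUnion.2 ⟨j, Or.inr ⟨hs0, h⟩⟩)
  set V : Fin T.card → Set G := fun j => {v | s ≤ φ v} ∩ {v | v⁻¹ * g j ∈ K} with hV
  have hVW : ∀ j, V j ⊆ W := fun j v hv => hφW v (hs0.trans_le hv.1)
  have hgK : ∀ j, g j ∈ K := fun j => subset_closure (hgO j)
  have hS : ∀ j, (V j)⁻¹ * {g j} = {h | h ∈ K ∧ s ≤ φ (g j * h⁻¹)} := by
    intro j
    ext h
    constructor
    · rintro ⟨v, hv, _, rfl, rfl⟩
      have hv1 : s ≤ φ v⁻¹ := hv.1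
      have hv2 : v⁻¹⁻¹ * g j ∈ K := hv.2
      rw [inv_inv] at hv2
      exact ⟨hv2, by simpa using hv1⟩
    · rintro ⟨hh, hs⟩
      refine ⟨h * (g j)⁻¹, ⟨?_, ?_⟩, g j, rfl, by simp⟩
      · simpa using hs
      · simpa using hh
  let c : KGraphingCode U K T.card :=
    { g := g
      V := V
      measurableSet := fun j => by
        refine MeasurableSet.inter ?_ ?_
        · exact (isClosed_le continuous_const φ.continuous).measurableSet
        · exact (hK.isClosed.preimage
            (show Continuous fun v : G => v⁻¹ * g j by fun_prop)).measurableSet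
      mem_nhds := fun j => by
        refine inter_mem ?_ ?_
        · have : {v | s < φ v} ∈ 𝓝 (1 : G) := by
            refine IsOpen.mem_nhds (isOpen_lt continuous_const φ.continuous) ?_
            simp only [mem_ofPred_eq, hφ1]
            linarith
          exact mem_of_superset this fun v hv => (le_of_lt hv : s ≤ φ v)
        · have h1 : Continuous fun v : G => v⁻¹ * g j := by fun_prop
          have h2 : O ∈ 𝓝 ((1 : G)⁻¹ * g j) := by simpa using hOo.mem_nhds (hgO j)
          exact mem_of_superset (h1.continuousAt.preimage_mem_nhds h2)
            fun v hv => subset_closure hv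
      subset := fun j v hv => (hWU _ (hVW j hv) _ (hVW j hv) (g j) (hgK j)).2.2
      conj_mul_subset := by
        rintro j _ ⟨_, ⟨_, ⟨_, rfl, v, hv, rfl⟩, _, rfl, rfl⟩, v', hv', rfl⟩
        exact (hWU _ (hVW j hv) _ (hVW j hv') (g j) (hgK j)).1
      conj_inv_subset := by
        rintro j _ ⟨_, ⟨_, rfl, v, hv, rfl⟩, _, rfl, rfl⟩
        have := (hWU _ (hVW j hv) _ (hVW j hv) (g j) (hgK j)).2.1
        rwa [inv_inv] at this
      iUnion_eq := by
        ext h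
        simp only [mem_iUnion, hS, mem_ofPred_eq]
        constructor
        · rintro ⟨j, hj, -⟩
          exact hj
        · intro hh
          obtain ⟨j, hj⟩ := hgcov h hh
          exact ⟨j, hh, (hs1.trans hj).le⟩ }
  refine ⟨T.card, c, fun j => ?_⟩
  change IsCompact ((V j)⁻¹ * {g j}) ∧ w (((V j)⁻¹ * {g j}) \ interior ((V j)⁻¹ * {g j})) = 0 ∧
    w (((V j)⁻¹ * {g j}) \ interior ((V j)⁻¹ * {g j}))⁻¹ = 0
  rw [hS]
  have hfr : {h | h ∈ K ∧ s ≤ φ (g j * h⁻¹)} \ interior {h | h ∈ K ∧ s ≤ φ (g j * h⁻¹)} ⊆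
      f ⁻¹' {t} ∪ (fun h => φ (g j * h⁻¹)) ⁻¹' {s} := by
    rintro h ⟨⟨hhK, hhs⟩, hhi⟩
    by_contra hne
    simp only [mem_union, mem_preimage, mem_singleton_iff, not_or] at hne
    refine hhi (mem_interior.2 ⟨O ∩ {h | s < φ (g j * h⁻¹)}, ?_, ?_, ?_, ?_⟩)
    · exact fun x hx => ⟨subset_closure hx.1, le_of_lt hx.2⟩
    · exact hOo.inter (isOpen_lt continuous_const (by fun_prop))
    · exact lt_of_le_of_ne (hKf h hhK) (Ne.symm hne.1)
    · exact lt_of_le_of_ne hhs (Ne.symm hne.2)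
  refine ⟨?_, ?_, ?_⟩
  · exact hK.inter_right (t := {h | s ≤ φ (g j * h⁻¹)})
      (isClosed_le continuous_const (by fun_prop))
  · exact measure_mono_null hfr (measure_union_null hwt (hws j).1)
  · refine measure_mono_null (inv_subset_inv.2 hfr) ?_
    rw [union_inv]
    refine measure_union_null ?_ ?_
    · convert hwt using 2
      ext h
      simp [hfinv]
    · convert (hws j).2 using 2
      ext h
      simp

end Code

/-! ### Edges of a graphing code -/

section Edge

variable {G X Y : Type*} [Group G] [MulAction G X]

/-- The outer measure on `G` which assigns to `S` the outer measure of the domain of `Θ^S`. -/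
def edgeOuter (m : OuterMeasure Y) (Ψ : G → Y → X) : OuterMeasure G where
  measureOf S := m (relPreimage (crossEdge Ψ S) univ)
  empty := by
    refine measure_mono_null (t := ∅) ?_ m.empty
    rintro y ⟨z, -, k, hk, -⟩
    exact hk
  mono {S T} h := m.mono fun y ⟨z, hz, k, hk, hyz⟩ => ⟨z, hz, k, h hk, hyz⟩
  iUnion_nat S _ := by
    refine (m.mono ?_).trans (measure_iUnion_le _)
    rintro y ⟨z, hz, k, hk, hyz⟩
    obtain ⟨i, hi⟩ := mem_iUnion.1 hk
    exact mem_iUnion.2 ⟨i, z, hz, k, hi, hyz⟩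

theorem crossEdge_inv_mul_singleton (Ψ : G → Y → X) {V : Set G} {g : G} {y y' : Y} :
    crossEdge Ψ (V⁻¹ * {g}) y y' ↔ ∃ v ∈ V, g • Ψ 1 y = v • Ψ 1 y' := by
  constructor
  · rintro ⟨_, ⟨v, hv, _, rfl, rfl⟩, h⟩
    exact ⟨v⁻¹, hv, by rw [← h, ← mul_smul]; simp⟩
  · rintro ⟨v, hv, h⟩
    exact ⟨v⁻¹ * g, mul_mem_mul (inv_mem_inv.2 hv) rfl, by rw [mul_smul, h, inv_smul_smul]⟩

theorem crossEdge_le_crossRel (Ψ : G → Y → X) {K : Set G} {y y' : Y} (h : crossEdge Ψ K y y') :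
    crossRel Ψ y y' :=
  let ⟨k, _, hk⟩ := h
  ⟨k, hk⟩

theorem crossRelGen_le_crossRel (Ψ : G → Y → X) {K : Set G} {y y' : Y}
    (h : crossRelGen Ψ K y y') : crossRel Ψ y y' := by
  induction h with
  | rel _ _ h => exact crossEdge_le_crossRel Ψ h
  | refl _ => exact (crossRel Ψ).refl _
  | symm _ _ _ ih => exact (crossRel Ψ).symm ih
  | trans _ _ _ _ _ ih ih' => exact (crossRel Ψ).trans ih ih'

variable [TopologicalSpace G] [MeasurableSpace G] {U K : Set G} {m : ℕ}

theorem KGraphingCode.exists_crossEdge_iff (c : KGraphingCode U K m) (Ψ : G → Y → X) {y y' : Y} :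
    (∃ j, crossEdge Ψ ((c.V j)⁻¹ * {c.g j}) y y') ↔ crossEdge Ψ K y y' := by
  constructor
  · rintro ⟨j, k, hk, h⟩
    exact ⟨k, c.iUnion_eq.subset (mem_iUnion.2 ⟨j, hk⟩), h⟩
  · rintro ⟨k, hk, h⟩
    obtain ⟨j, hj⟩ := mem_iUnion.1 (c.iUnion_eq.superset hk)
    exact ⟨j, k, hj, h⟩

theorem KGraphingCode.isSliceSet (c : KGraphingCode U K m) {U' : Set G} (hU : U ⊆ U')
    (j : Fin m) : IsSliceSet U' ((c.V j)⁻¹ * {c.g j}) := by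
  refine ⟨c.g j, ?_⟩
  rintro _ ⟨v, hv, _, rfl, rfl⟩
  refine ⟨hU ?_, hU ?_⟩
  · have h := c.subset j (mem_inv.1 hv)
    simpa using h
  · have h := c.conj_inv_subset j (mul_mem_mul (mul_mem_mul rfl hv) rfl)
    rwa [mul_assoc] at h

theorem KGraphingCode.isKGraphing (c : KGraphingCode U K m) {Ψ : G → Y → X} [MeasurableSpace Y]
    {ν : Measure Y} {𝓡 : GraphedRel ν (Fin m)}
    (h : ∀ j y y', (𝓡.graphing j).graph y y' ↔ crossEdge Ψ ((c.V j)⁻¹ * {c.g j}) y y') :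
    IsKGraphing Ψ c 𝓡 := by
  refine ⟨fun j y y' => (h j y y').trans (crossEdge_inv_mul_singleton Ψ), fun y y' => ?_⟩
  rw [← c.exists_crossEdge_iff Ψ]
  exact exists_congr fun j => h j y y'

end Edge

/-! ### Invariant null sets -/

section Saturation

variable {Y ι : Type*} [Countable ι] {m : OuterMeasure Y} {r : ι → Y → Y → Prop}

/-- A null set is contained in an invariant null set, for the equivalence relation generated by
countably many relations that preserve null sets. -/
theorem exists_null_invariant_superset
    (h : ∀ i S, m (relPreimage (r i) S) ≤ m S)
    (h' : ∀ i S, m (relPreimage (Function.swap (r i)) S) ≤ m S) {N : Set Y} (hN : m N = 0) :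
    ∃ N', N ⊆ N' ∧ m N' = 0 ∧
      ∀ y z, Relation.EqvGen (fun y z => ∃ i, r i y z) y z → (y ∈ N' ↔ z ∈ N') := by
  set T : Set Y → Set Y := fun A =>
    (⋃ i, relPreimage (r i) A) ∪ ⋃ i, relPreimage (Function.swap (r i)) A
  have hT : ∀ A, m A = 0 → m (T A) = 0 := fun A hA =>
    measure_union_null (measure_iUnion_null fun i => le_antisymm ((h i A).trans hA.le) bot_le)
      (measure_iUnion_null fun i => le_antisymm ((h' i A).trans hA.le) bot_le)
  refine ⟨⋃ k : ℕ, T^[k] N, subset_iUnion (fun k : ℕ => T^[k] N) 0, ?_, fun y z hyz => ?_⟩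
  · refine measure_iUnion_null fun k => ?_
    induction k with
    | zero => exact hN
    | succ k ih =>
      rw [Function.iterate_succ_apply']
      exact hT _ ih
  · induction hyz with
    | rel y z hyz =>
      obtain ⟨i, hi⟩ := hyz
      simp only [mem_iUnion]
      constructor
      · rintro ⟨k, hk⟩
        refine ⟨k + 1, ?_⟩
        rw [Function.iterate_succ_apply']
        exact Or.inr (mem_iUnion.2 ⟨i, y, hk, hi⟩)
      · rintro ⟨k, hk⟩
        refine ⟨k + 1, ?_⟩
        rw [Function.iterate_succ_apply']
        exact Or.inl (mem_iUnion.2 ⟨i, z, hk, hi⟩)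
    | refl => exact Iff.rfl
    | symm _ _ _ ih => exact ih.symm
    | trans _ _ _ _ _ ih ih' => exact ih.trans ih'

/-- Relations that agree off a null set generate equivalence relations that agree off a null
set. -/
theorem exists_null_forall_eqvGen {s : ι → Y → Y → Prop}
    (h : ∀ i S, m (relPreimage (r i) S) ≤ m S)
    (h' : ∀ i S, m (relPreimage (Function.swap (r i)) S) ≤ m S) {N : Set Y} (hN : m N = 0)
    (hrs : ∀ i y z, y ∉ N → r i y z → s i y z) :
    ∃ N', m N' = 0 ∧ ∀ y ∉ N', ∀ z, Relation.EqvGen (fun y z => ∃ i, r i y z) y z →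
      Relation.EqvGen (fun y z => ∃ i, s i y z) y z := by
  obtain ⟨N', hNN', hN', hinv⟩ := exists_null_invariant_superset h h' hN
  refine ⟨N', hN', fun y hy z hyz => ?_⟩
  induction hyz with
  | rel y z hyz =>
    obtain ⟨i, hi⟩ := hyz
    exact .rel _ _ ⟨i, hrs i _ _ (fun hyN => hy (hNN' hyN)) hi⟩
  | refl => exact .refl _
  | symm y z hyz ih => exact .symm _ _ (ih (mt (hinv _ _ hyz).1 hy))
  | trans y z w hyz _ ih ih' => exact .trans _ _ _ (ih hy) (ih' (mt (hinv _ _ hyz).2 hy))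

end Saturation

end CrossUltra

theorem mainTheorem9
    {G : Type*} [Group G] [TopologicalSpace G] [IsTopologicalGroup G] [T2Space G]
    [LocallyCompactSpace G] [SecondCountableTopology G] [MeasurableSpace G] [BorelSpace G]
    -- `G` is compactly generated
    (hG : ∃ C : Set G, IsCompact C ∧ Subgroup.closure C = ⊤)
    -- `G` is unimodular with Haar measure `haar`
    (haar : Measure G) [haar.IsHaarMeasure] [haar.IsMulRightInvariant]
    -- a non-principal ultrafilter
    (𝔲 : Ultrafilter ℕ) (h𝔲 : (𝔲 : Filter ℕ) ≤ cofinite)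
    -- Borel probability measure preserving actions on standard probability spaces
    {X : ℕ → Type*} [∀ n, MeasurableSpace (X n)] [∀ n, StandardBorelSpace (X n)]
    (μ : ∀ n, Measure (X n)) [∀ n, IsProbabilityMeasure (μ n)]
    [∀ n, MulAction G (X n)] [∀ n, MeasurableSMul₂ G (X n)]
    [∀ n, SMulInvariantMeasure G (X n) (μ n)]
    -- `U'`-cross sections for a (bounded) open neighborhood of the identity `U'`
    (U' : Set G) (hU'o : IsOpen U') (hU'1 : (1 : G) ∈ U') (hU'b : IsCompact (closure U'))
    (Y : ∀ n, Set (X n)) (hY : ∀ n, CrossUltra.IsCrossSection (μ n) U' (Y n))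
    (hcovol : ∃ c : ℝ≥0∞, c ≠ ∞ ∧ ∀ n, (CrossUltra.covolume haar (μ n) U' (Y n))⁻¹ ≤ c)
    -- compact neighborhoods of the identity
    (U : Set G) (hU : IsCompact U) (hU1 : U ∈ 𝓝 (1 : G)) (hUU' : U ⊆ U')
    (K' : Set G) (hK' : IsCompact K') (hUK' : U ⊆ K')
    (hlim : Tendsto (fun n => μ n (K' • Y n)) (𝔲 : Filter ℕ) (𝓝 1)) :
    -- the measures on the cross sections
    let ν : ∀ n, Measure (Y n) := fun n => CrossUltra.crossMeasure (μ n) U' (Y n)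
    ∃ K : Set G, IsCompact K ∧ K⁻¹ = K ∧ K' ⊆ K ∧
      -- the cross equivalence relation on `Y_𝔲` is `K`-generated
      CrossUltra.IsKGenerated (CrossUltra.ultraPsi G 𝔲 ν) (CrossUltra.loebMeasure 𝔲 ν) K ∧
      -- the ultraproduct of the `(R_n^K, Θ_n^K)` is `(R_𝔲, Θ_𝔲^K)`
      ∃ (m : ℕ) (c : CrossUltra.KGraphingCode U K m)
        (𝓡 : ∀ n, CrossUltra.GraphedRel (ν n) (Fin m))
        (𝒮 : CrossUltra.GraphedRel (CrossUltra.loebMeasure 𝔲 ν) (Fin m)),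
        (∀ n, (𝓡 n).rel = CrossUltra.crossRelGen (CrossUltra.actPsi (G := G) (Y n)) K ∧
          CrossUltra.IsKGraphing (CrossUltra.actPsi (Y n)) c (𝓡 n)) ∧
        𝒮.rel = CrossUltra.crossRel (CrossUltra.ultraPsi G 𝔲 ν) ∧
        CrossUltra.IsKGraphing (CrossUltra.ultraPsi G 𝔲 ν) c 𝒮 ∧
        CrossUltra.IsUltraproductOfGraphed 𝔲 ν 𝓡 𝒮 := by
  open CrossUltra in
  intro ν
  have hν : ∀ n, ν n = crossMeasure (μ n) U' (Y n) := fun _ => rfl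
  set Ψ := ultraPsi G 𝔲 ν
  obtain ⟨C, hC, hCgen⟩ := hG
  obtain ⟨N₂, hN₂, horbit⟩ :=
    exists_null_forall_smul_eq_smul hU'o hU'1 hU'b hY hν hU hU1 hK' hlim
  have h1U : (1 : G) ∈ U := mem_of_mem_nhds hU1
  set K₁ := U * U⁻¹ * K'
  have hK₁ : IsCompact K₁ := (hU.mul hU.inv).mul hK'
  have h1K₁ : (1 : G) ∈ K₁ :=
    ⟨1, ⟨1, h1U, 1, by simpa using h1U, one_mul 1⟩, 1, hUK' h1U, one_mul 1⟩
  set L := K' ∪ K₁⁻¹ * (C ∪ C⁻¹ ∪ {1}) * K₁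
  have hL : IsCompact L :=
    hK'.union ((hK₁.inv.mul ((hC.union hC.inv).union isCompact_singleton)).mul hK₁)
  obtain ⟨K, hK, hKinv, hLK, m, c, hc⟩ := exists_kGraphingCode
    (edgeOuter (loebOuter 𝔲 ν) Ψ)
    (fun F hF hFc => countable_setOf_level_ne_zero hU'o hU'1 hY hν hF hFc) hU1 hL
  set S : Fin m → Set G := fun j => (c.V j)⁻¹ * {c.g j}
  have hSc : ∀ j, IsCompact (S j) := fun j => (hc j).1
  have hS : ∀ j, IsSliceSet U' (S j) := fun j => c.isSliceSet hUU' j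
  have hfr : ∀ j, loebOuter 𝔲 ν (relPreimage (crossEdge Ψ (S j \ interior (S j))) univ) = 0 :=
    fun j => (hc j).2.1
  have hfr' : ∀ j, loebOuter 𝔲 ν (relPreimage (crossEdge Ψ (S j \ interior (S j))⁻¹) univ) = 0 :=
    fun j => (hc j).2.2
  have hpath : ∀ y ∉ N₂, ∀ y', crossRel Ψ y y' → crossRelGen Ψ K y y' := fun y hy y' h =>
    crossRelGen_of_forall_smul_eq_smul hCgen h1K₁ (subset_union_right.trans hLK) (horbit y hy) h
  have hKgen : IsKGenerated Ψ (loebMeasure 𝔲 ν) K :=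
    ⟨N₂, loebMeasure_eq_zero hN₂, fun y hy y' _ =>
      ⟨crossRelGen_le_crossRel Ψ, hpath y hy y'⟩⟩
  choose φ hφ using fun n j =>
    (hY n).exists_partialAut hU'o hU'1 hU'b haar (hSc j).measurableSet (hS j)
  choose ψ hψ using fun j =>
    exists_partialAut_ultraPsi h𝔲 hY hU'o hU'1 hU'b haar (hSc j) (hS j) hν (hfr j) (hfr' j)
  have hgen : ∀ n, (Relation.EqvGen.setoid fun y y' => ∃ j, (φ n j).graph y y') =
      crossRelGen (actPsi (G := G) (Y n)) K := by
    intro n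
    simp only [hφ, S, c.exists_crossEdge_iff]
    rfl
  have hgen' : (Relation.EqvGen.setoid fun y y' => ∃ j, (ψ j).graph y y') =
      crossRelGen Ψ K := by
    simp only [hψ, S, c.exists_crossEdge_iff, Ψ]
    rfl
  let 𝓡 : ∀ n, GraphedRel (ν n) (Fin m) := fun n =>
    { rel := crossRelGen (actPsi (G := G) (Y n)) K
      graphing := φ n
      graph_le := fun j y y' h => .rel _ _
        ((c.exists_crossEdge_iff _).1 ⟨j, (hφ n j y y').1 h⟩)
      generates := ⟨∅, measure_empty, fun y _ y' _ => by rw [hgen]⟩ }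
  let 𝒮 : GraphedRel (loebMeasure 𝔲 ν) (Fin m) :=
    { rel := crossRel Ψ
      graphing := ψ
      graph_le := fun j y y' h => crossEdge_le_crossRel Ψ ((hψ j y y').1 h)
      generates := by
        rw [hgen']
        exact hKgen }
  -- off the null set `N₁` the ultraproduct of the `φ_n^j` is `ψ^j`
  set N₁ := ⋃ j, relPreimage (crossEdge Ψ (S j \ interior (S j))) univ
  have hN₁ : loebOuter 𝔲 ν N₁ = 0 := measure_iUnion_null hfr
  have hultra : ∀ j y y', ultraRel 𝔲 ν (fun n => ((𝓡 n).graphing j).graph) y y' ↔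
      ultraRel 𝔲 ν (fun n => crossEdge (actPsi (Y n)) (S j)) y y' := by
    intro j y y'
    have : (fun n => ((𝓡 n).graphing j).graph) = fun n => crossEdge (actPsi (Y n)) (S j) :=
      funext fun n => funext fun a => funext fun b => propext (hφ n j a b)
    rw [this]
  have hsub : ∀ j y y', ultraRel 𝔲 ν (fun n => ((𝓡 n).graphing j).graph) y y' →
      crossEdge Ψ (S j) y y' := fun j y y' h =>
    crossEdge_of_ultraRel (hSc j) ((hultra j y y').1 h)
  have hsup : ∀ j y y', y ∉ N₁ → crossEdge Ψ (S j) y y' →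
      ultraRel 𝔲 ν (fun n => ((𝓡 n).graphing j).graph) y y' := fun j y y' hy h =>
    (hultra j y y').2 ((crossEdge_diff_interior_or_ultraRel h).resolve_left fun h' =>
      hy (mem_iUnion.2 ⟨j, y', trivial, h'⟩))
  refine ⟨K, hK, hKinv, subset_union_left.trans hLK, hKgen, m, c, 𝓡, 𝒮,
    fun n => ⟨rfl, c.isKGraphing (hφ n)⟩, rfl, c.isKGraphing hψ, fun j => ?_, ?_⟩
  · have h : ∀ᵐ y ∂(loebMeasure 𝔲 ν), y ∉ N₁ :=
      measure_eq_zero_iff_ae_notMem.1 (loebMeasure_eq_zero hN₁)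
    filter_upwards [h] with y hy y'
    exact ⟨fun h => (hψ j y y').2 (hsub j y y' h), fun h => hsup j y y' hy ((hψ j y y').1 h)⟩
  · obtain ⟨N₃, hN₃, h₃⟩ := exists_null_forall_eqvGen (m := loebOuter 𝔲 ν)
      (r := fun j => crossEdge Ψ (S j))
      (fun j => loebOuter_relPreimage_crossEdge_le h𝔲 hY hU'o hU'1 hU'b haar
        (hSc j).measurableSet (hS j) hν (hfr j))
      (fun j => by
        have h := hfr' j
        rw [sdiff_interior_inv] at h
        rw [swap_crossEdge]
        exact loebOuter_relPreimage_crossEdge_le h𝔲 hY hU'o hU'1 hU'b haar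
          (hSc j).measurableSet.inv (hS j).inv hν h)
      hN₁ hsup
    refine ⟨N₂ ∪ N₃, loebMeasure_eq_zero (measure_union_null hN₂ hN₃), fun y hy y' _ =>
      ⟨fun h => ?_, fun h => ?_⟩⟩
    · refine crossRelGen_le_crossRel Ψ (K := K) (Relation.EqvGen.mono (fun a b hab => ?_) _ _ h)
      obtain ⟨j, hj⟩ := hab
      exact (c.exists_crossEdge_iff Ψ).1 ⟨j, hsub j a b hj⟩
    · refine h₃ y (fun h => hy (Or.inr h)) y' ?_
      refine Relation.EqvGen.mono (fun a b hab => ?_) _ _ (hpath y (fun h => hy (Or.inl h)) y' h)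
      exact (c.exists_crossEdge_iff Ψ).2 hab
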